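/- Let $\mathbb K\in\{\mathbb R,\mathbb C\}$ and let $m\ge 2$. Write $\ell_p^n$ for $\mathbb K^n$ with the $\ell_p$ norm, $(e_j)$ for its canonical basis, and put $1/\infty=0$, $1/0=\infty$; a sum $(\sum_j|a_j|^s)^{1/s}$ with $s=\infty$ means $\sup_j|a_j|$. A Banach space $F$ has cotype $q$ ($2\le q<\infty$) with constant $\kappa$ if $(\sum_{i=1}^N\|x_i\|^q)^{1/q}\le\kappa\,\bigl(2^{-N}\sum_{\varepsilon\in\{-1,1\}^N}\|\sum_i\varepsilon_ix_i\|^2\bigr)^{1/2}$ for all finite families $x_1,\dots,x_N$ in $F$. A bounded linear operator $v\colon E\to F$ between Banach spaces is absolutely $(r,1)$-summing if there is $C\ge0$ with $(\sum_{i=1}^N\|v(x_i)\|^r)^{1/r}\le C\sup_{\varphi\in B_{E^*}}\sum_{i=1}^N|\varphi(x_i)|$ for all finite families in $E$; the infimum of such $C$ is $\pi_{r,1}(v)$. Let $p_1,\dots,p_m\in[1,\infty]$, $1\le r\le q$ and $2\le q<\infty$ satisfy $$\frac1{p_1}+\cdots+\frac1{p_m}=\frac1r\qquad\text{and}\qquad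 \frac1r-\frac1q\le\frac1{p_2}+\cdots+\frac1{p_m}<\frac1r .$$ Put $k_0:=\max\{t:\frac1{p_t}+\cdots+\frac1{p_m}\ge\frac1r-\frac1q\}$ and $$s_k=\Bigl[\frac1r-\Bigl(\frac1{p_k}+\cdots+\frac1{p_m}\Bigr)\Bigr]^{-1}\ (1\le k\le k_0),\qquad s_k=q\ (k>k_0),$$ so that $s_1=\infty$. (1) For all Banach spaces $E$ and $F$, where $F$ has cotype $q$, there is a constant $C_m$ such that $$\Bigl(\sum_{j_1=1}^n\Bigl(\cdots\Bigl(\sum_{j_m=1}^n\|vA(e_{j_1},\dots,e_{j_m})\|_F^{s_m}\Bigr)^{\frac{s_{m-1}}{s_m}}\cdots\Bigr)^{\frac{s_1}{s_2}}\Bigr)^{\frac1{s_1}}\le C_m\,\|A\|\,\pi_{r,1}(v)$$ for all $n$, all $m$-linear operators $A\colon\ell_{p_1}^n\times\cdots\times\ell_{p_m}^n\to E$ and all absolutely $(r,1)$-summing operators $v\colon E\to F$. The constant $C_m$ depends only on $m$ and on a cotype $q$ constant $\kappa$ of $F$ (not on $n,A,v,E$, nor otherwise on $F,p_1,\dots,p_m,r,q$).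 (2) The exponent $s_1=\infty$ cannot be improved: for all $p_1,\dots,p_m,r,q$ as above there are Banach spaces $E,F$, where $F$ has cotype $q$, and an absolutely $(r,1)$-summing operator $v\colon E\to F$ such that, for every $t\in(0,\infty)$, the inequality in (1) with $s_1$ replaced by $t$ and $s_2,\dots,s_m$ unchanged does not hold with any constant independent of $n$ and $A$. -/

import Mathlib

open scoped ENNReal

/-- The `ℓ_s` (quasi-)norm of a finite real sequence, `s ∈ (0, ∞]`; it is the supremum for
`s = ∞`. -/
noncomputable def lsNorm (s : ℝ≥0∞) {n : ℕ} (a : Fin n → ℝ) : ℝ :=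
  if s = ∞ then ⨆ i, |a i| else (∑ i, |a i| ^ s.toReal) ^ (1 / s.toReal)

/-- The mixed norm
`(∑_{j₁} ( ⋯ (∑_{jₘ} |a (j₁,…,jₘ)| ^ sₘ) ^ (sₘ₋₁ / sₘ) ⋯ ) ^ (s₁ / s₂)) ^ (1 / s₁)`,
with the first index outermost. -/
noncomputable def mixedNorm {n : ℕ} :
    (m : ℕ) → (Fin m → ℝ≥0∞) → ((Fin m → Fin n) → ℝ) → ℝ
  | 0, _, a => |a Fin.elim0|
  | m + 1, s, a =>
      lsNorm (s 0) fun j => mixedNorm m (Fin.tail s) fun J => a (Fin.cons j J)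

/-- `F` has cotype `q` with constant `κ`: for all finite families in `F`,
`(∑ ‖x i‖ ^ q) ^ (1 / q) ≤ κ * (𝔼 ‖∑ ε i • x i‖ ^ 2) ^ (1 / 2)`, the average being taken over
all choices of signs. -/
def HasCotypeWith (F : Type*) [NormedAddCommGroup F] (q κ : ℝ) : Prop :=
  ∀ (n : ℕ) (x : Fin n → F),
    (∑ i, ‖x i‖ ^ q) ^ (1 / q) ≤
      κ * √((∑ ε : Fin n → Bool, ‖∑ i, if ε i then x i else -x i‖ ^ 2) / 2 ^ n)

/-- `F` has cotype `q`. -/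
def HasCotype (F : Type*) [NormedAddCommGroup F] (q : ℝ) : Prop :=
  ∃ κ : ℝ, HasCotypeWith F q κ

section Summing

variable {𝕜 : Type*} [RCLike 𝕜]
  {E : Type*} [NormedAddCommGroup E] [NormedSpace 𝕜 E]
  {F : Type*} [NormedAddCommGroup F] [NormedSpace 𝕜 F]

/-- The weak `ℓ₁` norm `sup_{φ ∈ B_{E*}} ∑ |φ (x i)|` of a finite family. -/
noncomputable def weakL1Norm (𝕜 : Type*) [RCLike 𝕜] {E : Type*} [NormedAddCommGroup E]
    [NormedSpace 𝕜 E] {n : ℕ} (x : Fin n → E) : ℝ :=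
  ⨆ φ : Metric.closedBall (0 : StrongDual 𝕜 E) 1, ∑ i, ‖(φ : StrongDual 𝕜 E) (x i)‖

/-- `v` satisfies the `(r,1)`-summing inequality with constant `C`. -/
def IsSummingWith (r : ℝ) (v : E →L[𝕜] F) (C : ℝ) : Prop :=
  ∀ (n : ℕ) (x : Fin n → E), (∑ i, ‖v (x i)‖ ^ r) ^ (1 / r) ≤ C * weakL1Norm 𝕜 x

/-- `v` is absolutely `(r,1)`-summing. -/
def IsAbsSumming (r : ℝ) (v : E →L[𝕜] F) : Prop :=
  ∃ C : ℝ, IsSummingWith r v C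

/-- The `(r,1)`-summing norm `π_{r,1}(v)`: the infimum of the admissible constants. -/
noncomputable def summingNorm (r : ℝ) (v : E →L[𝕜] F) : ℝ :=
  sInf {C : ℝ | 0 ≤ C ∧ IsSummingWith r v C}

end Summing

/-- `1/p_k + ⋯ + 1/p_m`, with `1/∞ = 0`. -/
noncomputable def tailSum {m : ℕ} (p : Fin m → ℝ≥0∞) (k : Fin m) : ℝ :=
  ∑ j ∈ Finset.Ici k, (p j)⁻¹.toReal

/-- The numerical hypotheses of the critical case, together with the definition of the
index `k₀`. The positions `1, 2` of the text are the indices `0, 1` of `Fin m`. -/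
structure IsCritical {m : ℕ} (hm : 2 ≤ m) (p : Fin m → ℝ≥0∞) (r q : ℝ) (k₀ : Fin m) :
    Prop where
  one_le_r : 1 ≤ r
  r_le_q : r ≤ q
  two_le_q : 2 ≤ q
  sum_eq : ∑ j, (p j)⁻¹.toReal = 1 / r
  le_tail : 1 / r - 1 / q ≤ tailSum p ⟨1, hm⟩
  tail_lt : tailSum p ⟨1, hm⟩ < 1 / r
  isGreatest : IsGreatest {t : Fin m | 1 / r - 1 / q ≤ tailSum p t} k₀

/-- The exponents `s_k = [1/r - (1/p_k + ⋯ + 1/p_m)]⁻¹` for `k ≤ k₀` (with `1/0 = ∞`) and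
`s_k = q` for `k > k₀`. -/
noncomputable def critExponent {m : ℕ} (p : Fin m → ℝ≥0∞) (r q : ℝ) (k₀ k : Fin m) : ℝ≥0∞ :=
  if k ≤ k₀ then (ENNReal.ofReal (1 / r - tailSum p k))⁻¹ else ENNReal.ofReal q

/-- The array `‖v A(e_{j₁},…,e_{jₘ})‖` for an `m`-linear `A : ℓ_{p₁}ⁿ × ⋯ × ℓ_{pₘ}ⁿ → E`. -/
noncomputable def coeffArray {𝕜 : Type*} [RCLike 𝕜]
    {E : Type*} [NormedAddCommGroup E] [NormedSpace 𝕜 E]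
    {F : Type*} [NormedAddCommGroup F] [NormedSpace 𝕜 F]
    {m n : ℕ} {p : Fin m → ℝ≥0∞} [∀ j, Fact (1 ≤ p j)] (v : E →L[𝕜] F)
    (A : ContinuousMultilinearMap 𝕜 (fun j : Fin m => PiLp (p j) fun _ : Fin n => 𝕜) E)
    (J : Fin m → Fin n) : ℝ :=
  ‖v (A fun j => PiLp.single (p j) (J j) (1 : 𝕜))‖

/-! Since `s₁ = ∞`, the outer sum is a supremum and the first variable can be frozen at a basis
vector. The reciprocals of the remaining `p_k` add up to less than `1/r`, and those variables are
removed one at a time, starting with the last. With `a = 1/p_m`, `1/l = 1/r - a` and `Q = max q l`,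
the map `B ↦ (v B e_j)_j` from operators `ℓ_{p_m}ⁿ → E` to `ℓ_Qⁿ(F)` is again summing, now of type
`(l,1)` and at the cost of a factor `√2 κ` (`SummingOn.opBall`), while `ℓ_Qⁿ(F)` has cotype `Q` with
the same `κ` (`CotypeOn.lsSeminorm`). Iteration is `mixedNorm_le_of_summingOn`. Unit balls are plain
sets and norms plain seminorms there, so no operator spaces need to be built.

For one variable, random signs, cotype and the Kahane inequality `kahane_two_one` give `ℓ_r(ℓ_q)`
bounds for the rows and for the columns of a matrix, under every weight from the ball of `ℓ_{p_m}`
(`SummingOn.double`). A Hardy–Littlewood interpolation merges the two bounds (`mixed_sum_le_one`).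

For sharpness, `v` is the inclusion `ℓ_r → ℓ_{max 2 r}`. Its summability is the case of
`SummingOn.opBall` in which the scalar identity is `(1,1)`-summing and `a = 1 - 1/r`. Diagonal
operators have norm at most 1 by Hölder and `n` unit coefficients on the diagonal, which forces
growth `n^{1/t}`. -/

/-! ### Analysis on the discrete cube and the Kahane–Khinchin inequality. -/

/-- The vertex of the discrete cube obtained by flipping the `i`-th coordinate. -/
def flipAt {n : ℕ} (ε : Fin n → Bool) (i : Fin n) : Fin n → Bool :=
  Function.update ε i (!ε i)

/-- The sign attached to a Boolean. -/
def bsign (b : Bool) : ℝ := if b then 1 else -1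

theorem sum_cube_succ {n : ℕ} (f : (Fin (n + 1) → Bool) → ℝ) :
    ∑ ε, f ε = ∑ ε : Fin n → Bool, f (Fin.cons false ε) + ∑ ε : Fin n → Bool, f (Fin.cons true ε) := by
  rw [← (Fin.consEquiv fun _ : Fin (n + 1) => Bool).sum_comp, Fintype.sum_prod_type]
  simp [Fin.consEquiv, add_comm]

theorem flipAt_cons_zero {n : ℕ} (b : Bool) (ε : Fin n → Bool) :
    flipAt (Fin.cons b ε : Fin (n + 1) → Bool) 0 = Fin.cons (!b) ε := by
  simp [flipAt]

theorem flipAt_cons_succ {n : ℕ} (b : Bool) (ε : Fin n → Bool) (i : Fin n) :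
    flipAt (Fin.cons b ε : Fin (n + 1) → Bool) i.succ = Fin.cons b (flipAt ε i) := by
  simp [flipAt, Fin.cons_update]

/-- The Dirichlet form of the discrete cube. -/
def cubeEnergy {n : ℕ} (f : (Fin n → Bool) → ℝ) : ℝ :=
  ∑ ε, ∑ i, (f ε - f (flipAt ε i)) ^ 2

theorem cubeEnergy_succ {n : ℕ} (f : (Fin (n + 1) → Bool) → ℝ) :
    cubeEnergy f = cubeEnergy (fun ε => f (Fin.cons false ε)) +
      cubeEnergy (fun ε => f (Fin.cons true ε)) +
      2 * ∑ ε : Fin n → Bool, (f (Fin.cons true ε) - f (Fin.cons false ε)) ^ 2 := by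
  unfold cubeEnergy
  rw [sum_cube_succ]
  simp only [Fin.sum_univ_succ, flipAt_cons_zero, flipAt_cons_succ, Finset.sum_add_distrib,
    Bool.not_false, Bool.not_true]
  have : ∑ ε : Fin n → Bool, (f (Fin.cons false ε) - f (Fin.cons true ε)) ^ 2 =
      ∑ ε : Fin n → Bool, (f (Fin.cons true ε) - f (Fin.cons false ε)) ^ 2 :=
    Finset.sum_congr rfl fun ε _ => by ring
  rw [this]
  ring

theorem cubeEnergy_parallelogram {n : ℕ} (f g : (Fin n → Bool) → ℝ) :
    cubeEnergy (fun ε => f ε + g ε) + cubeEnergy (fun ε => g ε - f ε) =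
      2 * (cubeEnergy f + cubeEnergy g) := by
  unfold cubeEnergy
  simp only [← Finset.sum_add_distrib, Finset.mul_sum]
  exact Finset.sum_congr rfl fun ε _ => Finset.sum_congr rfl fun i _ => by ring

/-- The Poincaré inequality on the discrete cube. -/
theorem cube_poincare {n : ℕ} (f : (Fin n → Bool) → ℝ) :
    2 ^ n * ∑ ε, f ε ^ 2 - (∑ ε, f ε) ^ 2 ≤ 2 ^ n * cubeEnergy f / 4 := by
  induction n with
  | zero => simp [cubeEnergy]
  | succ n ih =>
    rw [cubeEnergy_succ, sum_cube_succ f, sum_cube_succ fun ε => f ε ^ 2]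
    have h0 := ih fun ε => f (Fin.cons false ε)
    have h1 := ih fun ε => f (Fin.cons true ε)
    -- Cauchy–Schwarz: the gap between the two half-cube sums is absorbed by the energy in the new
    -- direction.
    have h2 := sq_sum_le_card_mul_sum_sq (s := Finset.univ)
      (f := fun ε : Fin n → Bool => f (Fin.cons true ε) - f (Fin.cons false ε))
    simp only [Finset.sum_sub_distrib, Finset.card_univ, Fintype.card_pi, Fintype.card_bool,
      Finset.prod_const, Fintype.card_fin, Nat.cast_pow, Nat.cast_ofNat] at h2
    rw [pow_succ]
    nlinarith

/-- The Poincaré inequality on the discrete cube with the first level of the spectrum separated. -/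
theorem cube_poincare_two {n : ℕ} (f : (Fin n → Bool) → ℝ) :
    2 * (2 ^ n * ∑ ε, f ε ^ 2 - (∑ ε, f ε) ^ 2) ≤
      2 ^ n * cubeEnergy f / 4 + ∑ i, (∑ ε, f ε * bsign (ε i)) ^ 2 := by
  induction n with
  | zero => simp [cubeEnergy]
  | succ n ih =>
    -- Walsh characters avoiding the new coordinate live in the sum of the halves, which takes the
    -- induction hypothesis. The others live in the difference, where their degree drops by one, so
    -- plain Poincaré is enough.
    have hg := ih fun ε => f (Fin.cons false ε) + f (Fin.cons true ε)
    have hh := cube_poincare fun ε : Fin n → Bool => f (Fin.cons true ε) - f (Fin.cons false ε)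
    have hD := cubeEnergy_parallelogram (fun ε : Fin n → Bool => f (Fin.cons false ε))
      (fun ε => f (Fin.cons true ε))
    have hS : ∑ ε : Fin n → Bool, (f (Fin.cons false ε) + f (Fin.cons true ε)) ^ 2 +
        ∑ ε : Fin n → Bool, (f (Fin.cons true ε) - f (Fin.cons false ε)) ^ 2 =
        2 * (∑ ε : Fin n → Bool, f (Fin.cons false ε) ^ 2 +
          ∑ ε : Fin n → Bool, f (Fin.cons true ε) ^ 2) := by
      simp only [← Finset.sum_add_distrib, Finset.mul_sum]
      exact Finset.sum_congr rfl fun ε _ => by ring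
    have hL : ∑ i, (∑ ε, f ε * bsign (ε i)) ^ 2 =
        (∑ ε : Fin n → Bool, (f (Fin.cons true ε) - f (Fin.cons false ε))) ^ 2 +
        ∑ i : Fin n, (∑ ε : Fin n → Bool,
          (f (Fin.cons false ε) + f (Fin.cons true ε)) * bsign (ε i)) ^ 2 := by
      rw [Fin.sum_univ_succ, sum_cube_succ]
      congr 1
      · rw [← Finset.sum_add_distrib]
        congr 1
        exact Finset.sum_congr rfl fun ε _ => by simp [bsign]; ring
      · refine Finset.sum_congr rfl fun i _ => ?_
        rw [sum_cube_succ, ← Finset.sum_add_distrib]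
        congr 1
        exact Finset.sum_congr rfl fun ε _ => by simp [add_mul]
    rw [hL, cubeEnergy_succ, sum_cube_succ f, sum_cube_succ fun ε => f ε ^ 2]
    rw [Finset.sum_add_distrib] at hg
    rw [pow_succ]
    have e1 : 2 ^ n * cubeEnergy (fun ε : Fin n → Bool => f (Fin.cons false ε)) +
      2 ^ n * cubeEnergy (fun ε : Fin n → Bool => f (Fin.cons true ε)) = (2 ^ n *
      cubeEnergy (fun ε : Fin n → Bool => f (Fin.cons false ε) + f (Fin.cons true ε)) +
      2 ^ n * cubeEnergy (fun ε : Fin n → Bool => f (Fin.cons true ε) - f (Fin.cons false ε))) / 2 := by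
      rw [← mul_add, ← mul_add, hD]; ring
    have e2 := congrArg (fun t => (2 : ℝ) ^ n * t) hS
    simp only [mul_add] at e2
    nlinarith

theorem cube_sum_flip {n : ℕ} (i : Fin n) (f : (Fin n → Bool) → ℝ) :
    ∑ ε, f (flipAt ε i) = ∑ ε, f ε := by
  have h : Function.Involutive fun ε : Fin n → Bool => flipAt ε i := fun ε => by
    simp [flipAt]
  exact h.bijective.sum_comp f

theorem cube_sum_neg {n : ℕ} (f : (Fin n → Bool) → ℝ) :
    ∑ ε : Fin n → Bool, f (fun i => !ε i) = ∑ ε, f ε := by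
  have h : Function.Involutive fun ε : Fin n → Bool => fun i => !ε i := fun ε => by simp
  exact h.bijective.sum_comp f

section Kahane

variable {𝕜 : Type*} [RCLike 𝕜] {X : Type*} [AddCommGroup X] [Module 𝕜 X]

/-- The signed sum `∑ ε i • x i`. -/
def signSum {X : Type*} [AddCommGroup X] {n : ℕ} (x : Fin n → X) (ε : Fin n → Bool) : X :=
  ∑ i, if ε i then x i else -x i

theorem signSum_flipAt {n : ℕ} (x : Fin n → X) (ε : Fin n → Bool) (i : Fin n) :
    signSum x (flipAt ε i) = signSum x ε - (2 : 𝕜) • (if ε i then x i else -x i) := by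
  unfold signSum
  rw [eq_sub_iff_add_eq, ← Finset.add_sum_erase _ _ (Finset.mem_univ i),
    ← Finset.add_sum_erase _ (fun j => if ε j then x j else -x j) (Finset.mem_univ i)]
  have : ∑ j ∈ Finset.univ.erase i, (if flipAt ε i j then x j else -x j) =
      ∑ j ∈ Finset.univ.erase i, (if ε j then x j else -x j) :=
    Finset.sum_congr rfl fun j hj => by
      simp [flipAt, Function.update_of_ne (Finset.ne_of_mem_erase hj)]
  rw [this, two_smul]
  cases h : ε i <;> simp [flipAt, h] <;> abel

theorem signSum_neg {n : ℕ} (x : Fin n → X) (ε : Fin n → Bool) :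
    signSum x (fun i => !ε i) = -signSum x ε := by
  unfold signSum
  rw [← Finset.sum_neg_distrib]
  exact Finset.sum_congr rfl fun i _ => by cases h : ε i <;> simp [h]

/-- The Kahane–Khinchin inequality between the first and the second moment. -/
theorem kahane_two_one (G : Seminorm 𝕜 X) {n : ℕ} (x : Fin n → X) :
    2 ^ n * ∑ ε, G (signSum x ε) ^ 2 ≤ 2 * (∑ ε, G (signSum x ε)) ^ 2 := by
  have h := cube_poincare_two fun ε => G (signSum x ε)
  -- The function `ε ↦ G (signSum x ε)` is even, so its first-level coefficients vanish and the
  -- spectral gap doubles.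
  have hL : ∀ i, ∑ ε, G (signSum x ε) * bsign (ε i) = 0 := fun i => by
    have h1 := cube_sum_neg fun ε => G (signSum x ε) * bsign (ε i)
    have h2 : ∑ ε : Fin n → Bool, G (signSum x fun i => !ε i) * bsign (!ε i) =
        -∑ ε, G (signSum x ε) * bsign (ε i) := by
      rw [← Finset.sum_neg_distrib]
      refine Finset.sum_congr rfl fun ε _ => ?_
      rw [signSum_neg, map_neg_eq_map]
      cases h : ε i <;> simp [bsign]
    linarith
  -- The neighbours of a vertex satisfy `∑ i, signSum x (flipAt ε i) = (n - 2) • signSum x ε`. The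
  -- triangle inequality then makes the energy at most `4 ∑ G²`.
  have key : ∀ ε, ((n : ℝ) - 2) * G (signSum x ε) ≤ ∑ i, G (signSum x (flipAt ε i)) := fun ε => by
    have h1 : ∑ i, signSum x (flipAt ε i) = ((n : 𝕜) - 2) • signSum x ε := by
      simp only [signSum_flipAt (𝕜 := 𝕜)]
      rw [Finset.sum_sub_distrib, ← Finset.smul_sum, sub_smul]
      simp [signSum, Nat.cast_smul_eq_nsmul]
    have h2 : G (∑ i, signSum x (flipAt ε i)) ≤ ∑ i, G (signSum x (flipAt ε i)) :=
      Finset.le_sum_of_subadditive G (map_zero G).le (map_add_le_add G) _ _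
    refine le_trans ?_ h2
    rw [h1, map_smul_eq_mul]
    refine mul_le_mul_of_nonneg_right ?_ (apply_nonneg G _)
    have : ((n : 𝕜) - 2) = (((n : ℝ) - 2 : ℝ) : 𝕜) := by push_cast; rfl
    rw [this, RCLike.norm_ofReal]
    exact le_abs_self _
  have hD : cubeEnergy (fun ε => G (signSum x ε)) ≤ 4 * ∑ ε, G (signSum x ε) ^ 2 := by
    have e : cubeEnergy (fun ε => G (signSum x ε)) = 2 * (n * ∑ ε, G (signSum x ε) ^ 2 -
        ∑ ε, G (signSum x ε) * ∑ i, G (signSum x (flipAt ε i))) := by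
      unfold cubeEnergy
      have e1 : ∀ ε : Fin n → Bool, ∑ i, (G (signSum x ε) - G (signSum x (flipAt ε i))) ^ 2 =
          n * G (signSum x ε) ^ 2 - 2 * (G (signSum x ε) * ∑ i, G (signSum x (flipAt ε i))) +
          ∑ i, G (signSum x (flipAt ε i)) ^ 2 := fun ε => by
        simp only [sub_sq, Finset.sum_add_distrib, Finset.sum_sub_distrib, Finset.mul_sum]
        simp [mul_assoc]
      simp only [e1, Finset.sum_add_distrib, Finset.sum_sub_distrib]
      rw [Finset.sum_comm (f := fun ε i => G (signSum x (flipAt ε i)) ^ 2)]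
      simp only [cube_sum_flip _ fun ε => G (signSum x ε) ^ 2, ← Finset.mul_sum]
      simp
      ring
    have h2 : ((n : ℝ) - 2) * ∑ ε, G (signSum x ε) ^ 2 ≤
        ∑ ε, G (signSum x ε) * ∑ i, G (signSum x (flipAt ε i)) := by
      rw [Finset.mul_sum]
      refine Finset.sum_le_sum fun ε _ => ?_
      nlinarith [mul_le_mul_of_nonneg_left (key ε) (apply_nonneg G (signSum x ε))]
    rw [e]
    linarith
  simp only [hL] at h
  have := mul_le_mul_of_nonneg_left hD (by positivity : (0 : ℝ) ≤ 2 ^ n)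
  simp at h
  nlinarith

end Kahane

/-! ### Inequalities for finite sums and the interpolation step. -/

theorem sum_rpow_le_rpow_sum {ι : Type*} (s : Finset ι) {x : ι → ℝ} (hx : ∀ i, 0 ≤ x i) {t : ℝ}
    (ht : 1 ≤ t) : ∑ i ∈ s, x i ^ t ≤ (∑ i ∈ s, x i) ^ t := by
  induction s using Finset.cons_induction with
  | empty => simp [Real.zero_rpow (by linarith : t ≠ 0)]
  | cons i s hi ih =>
    rw [Finset.sum_cons, Finset.sum_cons]
    exact (add_le_add le_rfl ih).trans
      (Real.add_rpow_le_rpow_add (hx i) (Finset.sum_nonneg fun j _ => hx j) ht)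

theorem ls_norm_anti {ι : Type*} (s : Finset ι) {x : ι → ℝ} (hx : ∀ i, 0 ≤ x i) {p q : ℝ}
    (hp : 0 < p) (hpq : p ≤ q) :
    (∑ i ∈ s, x i ^ q) ^ (1 / q) ≤ (∑ i ∈ s, x i ^ p) ^ (1 / p) := by
  have hq : 0 < q := hp.trans_le hpq
  have h := sum_rpow_le_rpow_sum s (x := fun i => x i ^ p) (fun i => by positivity [hx i])
    ((one_le_div hp).2 hpq)
  have h' : ∑ i ∈ s, x i ^ q ≤ (∑ i ∈ s, x i ^ p) ^ (q / p) := by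
    refine le_trans (le_of_eq (Finset.sum_congr rfl fun i _ => ?_)) h
    rw [← Real.rpow_mul (hx i), mul_div_cancel₀ _ hp.ne']
  refine (Real.rpow_le_rpow (Finset.sum_nonneg fun i _ => Real.rpow_nonneg (hx i) _) h'
    (by positivity)).trans (le_of_eq ?_)
  rw [← Real.rpow_mul (Finset.sum_nonneg fun i _ => Real.rpow_nonneg (hx i) _)]
  congr 1
  field_simp

theorem minkowski_sum {ι κ : Type*} [Fintype ι] (s : Finset κ) {h : κ → ι → ℝ}
    (hh : ∀ k i, 0 ≤ h k i) {t : ℝ} (ht : 1 ≤ t) :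
    (∑ i, (∑ k ∈ s, h k i) ^ t) ^ (1 / t) ≤ ∑ k ∈ s, (∑ i, h k i ^ t) ^ (1 / t) := by
  have ht0 : t ≠ 0 := by linarith
  induction s using Finset.cons_induction with
  | empty => simp [Real.zero_rpow ht0, Real.zero_rpow (inv_ne_zero ht0)]
  | cons k s hk ih =>
    simp only [Finset.sum_cons]
    exact (Real.Lp_add_le_of_nonneg _ ht (fun i _ => hh k i)
      (fun i _ => Finset.sum_nonneg fun l _ => hh l i)).trans (add_le_add le_rfl ih)

theorem sum_geom_mean_le {ι : Type*} (s : Finset ι) {u w : ι → ℝ} (hu : ∀ i, 0 ≤ u i)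
    (hw : ∀ i, 0 ≤ w i) {θ : ℝ} (h0 : 0 ≤ θ) (h1 : θ < 1) :
    ∑ i ∈ s, u i ^ (1 - θ) * w i ^ θ ≤ (∑ i ∈ s, u i) ^ (1 - θ) * (∑ i ∈ s, w i) ^ θ := by
  rcases h0.eq_or_lt with rfl | h0
  · simp
  have hc : (1 / (1 - θ)).HolderConjugate (1 / θ) := by
    rw [Real.holderConjugate_iff]
    refine ⟨?_, by simp⟩
    rw [lt_div_iff₀ (by linarith)]; linarith
  have h := Real.inner_le_Lp_mul_Lq_of_nonneg s hc (f := fun i => u i ^ (1 - θ))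
    (g := fun i => w i ^ θ) (fun i _ => Real.rpow_nonneg (hu i) _)
    (fun i _ => Real.rpow_nonneg (hw i) _)
  have e1 : ∀ i, (u i ^ (1 - θ)) ^ (1 / (1 - θ)) = u i := fun i => by
    rw [← Real.rpow_mul (hu i), mul_one_div_cancel (by linarith), Real.rpow_one]
  have e2 : ∀ i, (w i ^ θ) ^ (1 / θ) = w i := fun i => by
    rw [← Real.rpow_mul (hw i), mul_one_div_cancel h0.ne', Real.rpow_one]
  simpa only [e1, e2, one_div_one_div] using h

theorem rpow_average_le {ι : Type*} [Fintype ι] {f : ι → ℝ} (hf : ∀ i, 0 ≤ f i) {N r : ℝ}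
    (hN : (Fintype.card ι : ℝ) = N) (hN0 : 0 < N) (hr : 1 ≤ r) :
    ((∑ i, f i) / N) ^ r ≤ (∑ i, f i ^ r) / N := by
  have h := Real.rpow_arith_mean_le_arith_mean_rpow Finset.univ (fun _ => 1 / N) f
    (fun i _ => by positivity) (by simp [hN, hN0.ne']) (fun i _ => hf i) hr
  simpa [← Finset.mul_sum, div_eq_inv_mul] using h

/-- The converse of Hölder's inequality, tested on the vectors `y ^ a` with `y` in the unit ball of
`ℓ₁`. -/
theorem sum_rpow_le_one_of_weighted {ι : Type*} [Fintype ι] {T : ι → ℝ} (hT : ∀ j, 0 ≤ T j)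
    {a r : ℝ} (hr : 0 < r) (har : 0 < 1 / r - a)
    (h : ∀ y : ι → ℝ, (∀ j, 0 ≤ y j) → ∑ j, y j ≤ 1 → ∑ j, (y j ^ a * T j) ^ r ≤ 1) :
    ∑ j, T j ^ (1 / r - a)⁻¹ ≤ 1 := by
  set l := (1 / r - a)⁻¹ with hl
  have hl0 : 0 < l := inv_pos.2 har
  have hla : 1 / l = 1 / r - a := by rw [hl, one_div, inv_inv]
  set Z := ∑ j, T j ^ l with hZ
  have hTl : ∀ j, 0 ≤ T j ^ l := fun j => Real.rpow_nonneg (hT j) _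
  have hZ0 : 0 ≤ Z := Finset.sum_nonneg fun j _ => hTl j
  rcases hZ0.eq_or_lt with h0 | hZp
  · rw [← h0]; exact zero_le_one
  -- The extremal weight of Hölder's inequality: the tested sum becomes `Z / Z ^ (a * r)`, and `a *
  -- r < 1`.
  have h1 := h (fun j => T j ^ l / Z) (fun j => by positivity [hTl j])
    (by rw [← Finset.sum_div, div_self hZp.ne'])
  have e : ∀ j, ((T j ^ l / Z) ^ a * T j) ^ r = T j ^ l / Z ^ (a * r) := fun j => by
    rw [Real.mul_rpow (by positivity [hTl j]) (hT j), Real.div_rpow (hTl j) hZ0,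
      Real.div_rpow (by positivity [hTl j]) (by positivity), ← Real.rpow_mul hZ0,
      ← Real.rpow_mul (hT j), ← Real.rpow_mul (hT j), div_mul_eq_mul_div]
    congr 1
    rcases (hT j).eq_or_lt with h0 | hp
    · rw [← h0, Real.zero_rpow hr.ne', Real.zero_rpow hl0.ne', mul_zero]
    · rw [← Real.rpow_add hp]
      congr 1
      have : l * (1 / l) = 1 := by field_simp
      rw [hla] at this
      have h2 : r * (1 / r) = 1 := by field_simp
      linear_combination (-r) * this + l * h2
  simp only [e] at h1
  rw [← Finset.sum_div, ← hZ] at h1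
  by_contra hcon
  have hc : 1 < Z := not_le.1 hcon
  have h2 : Z ^ (a * r) < Z ^ (1 : ℝ) := by
    refine Real.rpow_lt_rpow_of_exponent_lt hc ?_
    have := mul_pos hr har
    have h2 : r * (1 / r) = 1 := by field_simp
    nlinarith
  rw [Real.rpow_one] at h2
  rw [div_le_one (by positivity)] at h1
  linarith

/-- The Hardy–Littlewood type interpolation step for matrices. -/
theorem mixed_sum_le_one {ι κ : Type*} [Fintype ι] [Fintype κ] {b : ι → κ → ℝ}
    (hb : ∀ i j, 0 ≤ b i j) {a r q : ℝ} (hr : 0 < r) (hrq : r ≤ q) (ha : 0 ≤ a)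
    (har : 0 < 1 / r - a)
    (h1 : ∀ y : κ → ℝ, (∀ j, 0 ≤ y j) → ∑ j, y j ≤ 1 →
      ∑ i, (∑ j, (y j ^ a * b i j) ^ q) ^ (r / q) ≤ 1)
    (h2 : ∀ y : κ → ℝ, (∀ j, 0 ≤ y j) → ∑ j, y j ≤ 1 →
      ∑ j, (∑ i, (y j ^ a * b i j) ^ q) ^ (r / q) ≤ 1) :
    ∑ i, (∑ j, b i j ^ max q (1 / r - a)⁻¹) ^ ((1 / r - a)⁻¹ / max q (1 / r - a)⁻¹) ≤ 1 := by
  have hq : 0 < q := hr.trans_le hrq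
  have hbq : ∀ i j, 0 ≤ b i j ^ q := fun i j => Real.rpow_nonneg (hb i j) _
  set T : κ → ℝ := fun j => (∑ i, b i j ^ q) ^ (1 / q) with hTdef
  have hs0 : ∀ j, 0 ≤ ∑ i, b i j ^ q := fun j => Finset.sum_nonneg fun i _ => hbq i j
  have hT : ∀ j, 0 ≤ T j := fun j => Real.rpow_nonneg (hs0 j) _
  have hTq : ∀ j, T j ^ q = ∑ i, b i j ^ q := fun j => by
    simp only [hTdef]
    rw [← Real.rpow_mul (hs0 j), one_div_mul_cancel hq.ne', Real.rpow_one]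
  -- For all weights `y` the column bound reads `∑ (y_j ^ a T_j) ^ r ≤ 1`, so duality puts the
  -- column norms in the unit ball of `ℓ_l`.
  have hTl := sum_rpow_le_one_of_weighted hT hr har fun y hy hy1 => by
    refine le_trans (le_of_eq (Finset.sum_congr rfl fun j _ => ?_)) (h2 y hy hy1)
    have hya : 0 ≤ y j ^ a := Real.rpow_nonneg (hy j) _
    simp only [Real.mul_rpow hya (hb _ _)]
    rw [← Finset.mul_sum, ← hTq, ← Real.mul_rpow hya (hT j),
      ← Real.rpow_mul (mul_nonneg hya (hT j)), mul_div_cancel₀ _ hq.ne']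
  set l := (1 / r - a)⁻¹ with hl
  have hl0 : 0 < l := inv_pos.2 har
  have hla : 1 / l = 1 / r - a := by rw [hl, one_div, inv_inv]
  rcases le_or_gt q l with hql | hlq
  · rw [max_eq_right hql, div_self hl0.ne']
    simp only [Real.rpow_one]
    rw [Finset.sum_comm]
    refine le_trans (Finset.sum_le_sum fun j _ => ?_) hTl
    have := sum_rpow_le_rpow_sum Finset.univ (x := fun i => b i j ^ q) (fun i => hbq i j)
      ((one_le_div hq).2 hql)
    simp only [← Real.rpow_mul (hb _ _), mul_div_cancel₀ _ hq.ne'] at this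
    rwa [← hTq, ← Real.rpow_mul (hT j), mul_div_cancel₀ _ hq.ne'] at this
  rw [max_eq_left hlq.le]
  have hTl0 : ∀ j, 0 ≤ T j ^ l := fun j => Real.rpow_nonneg (hT j) _
  -- The column norms supply the weight for the row bound. The exponent `d` is chosen so that `T_j ^
  -- q * y_j ^ (-d) = T_j ^ l`, which gives `∑ W_i ≤ 1`.
  set y : κ → ℝ := fun j => T j ^ l with hy
  set d := q / l - 1 with hd
  have hd0 : 0 < d := by rw [hd, sub_pos, one_lt_div hl0]; exact hlq
  set U : ι → ℝ := fun i => ∑ j, (y j ^ a * b i j) ^ q with hU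
  set W : ι → ℝ := fun i => ∑ j, b i j ^ q * y j ^ (-d) with hW
  have hya : ∀ j, 0 ≤ y j ^ a := fun j => Real.rpow_nonneg (hTl0 j) _
  have hyd : ∀ j, 0 ≤ y j ^ (-d) := fun j => Real.rpow_nonneg (hTl0 j) _
  have hub : ∀ i j, 0 ≤ (y j ^ a * b i j) ^ q := fun i j =>
    Real.rpow_nonneg (mul_nonneg (hya j) (hb i j)) _
  have hwb : ∀ i j, 0 ≤ b i j ^ q * y j ^ (-d) := fun i j => mul_nonneg (hbq i j) (hyd j)
  have hU0 : ∀ i, 0 ≤ U i := fun i => Finset.sum_nonneg fun j _ => hub i j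
  have hW0 : ∀ i, 0 ≤ W i := fun i => Finset.sum_nonneg fun j _ => hwb i j
  have hUs : ∑ i, U i ^ (r / q) ≤ 1 := h1 y hTl0 hTl
  have hWs : ∑ i, W i ≤ 1 := by
    simp only [hW]
    rw [Finset.sum_comm]
    refine le_trans (Finset.sum_le_sum fun j _ => ?_) hTl
    rw [← Finset.sum_mul, ← hTq]
    simp only [hy]
    rw [← Real.rpow_mul (hT j)]
    rcases (hT j).eq_or_lt with h0 | hp
    · rw [← h0, Real.zero_rpow hq.ne', Real.zero_rpow hl0.ne', zero_mul]
    · rw [← Real.rpow_add hp]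
      refine le_of_eq ?_
      congr 1
      rw [hd]; field_simp; ring
  have hrl : 1 / q < 1 / r - a := by
    rw [← hla]; exact one_div_lt_one_div_of_lt hl0 hlq
  have hden : 0 < 1 / r - 1 / q := by linarith
  -- This `θ` makes the powers of `y` cancel in the product of the two weighted terms.
  set θ := a / (1 / r - 1 / q) with hθ
  have hθ0 : 0 ≤ θ := by positivity
  have hθ1 : θ < 1 := by rw [hθ, div_lt_one hden]; linarith
  have hθa : θ * (1 / r - 1 / q) = a := div_mul_cancel₀ _ hden.ne'
  have hbal : a * q * (1 - θ) = d * θ := by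
    have h3 : d = q * (1 / r - a) - 1 := by rw [hd, ← hla]; ring
    have h4 : q * (1 / q) = 1 := by field_simp
    rw [h3]
    linear_combination (-q) * hθa - θ * h4
  have hS : ∀ i, ∑ j, b i j ^ q ≤ U i ^ (1 - θ) * W i ^ θ := fun i => by
    refine le_trans (Finset.sum_le_sum fun j _ => ?_)
      (sum_geom_mean_le Finset.univ (hub i) (hwb i) hθ0 hθ1)
    rcases (hTl0 j).eq_or_lt with h0 | hp
    -- A zero weight means a zero column, so nothing is lost there.
    · have hTj : T j = 0 := by
        by_contra hne
        exact (Real.rpow_pos_of_pos ((hT j).lt_of_ne' hne) l).ne h0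
      have h5 := hTq j
      rw [hTj, Real.zero_rpow hq.ne'] at h5
      have h6 := (Finset.sum_eq_zero_iff_of_nonneg fun i _ => hbq i j).1 h5.symm i (Finset.mem_univ _)
      rw [h6]
      exact mul_nonneg (Real.rpow_nonneg (hub i j) _) (Real.rpow_nonneg (by simp) _)
    · have hyp : 0 < y j := hp
      rw [Real.mul_rpow (hya j) (hb i j), Real.mul_rpow (by positivity) (hbq i j),
        Real.mul_rpow (hbq i j) (hyd j), ← Real.rpow_mul hyp.le, ← Real.rpow_mul hyp.le,
        ← Real.rpow_mul hyp.le]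
      have e1 : y j ^ (a * q * (1 - θ)) * (b i j ^ q) ^ (1 - θ) *
          ((b i j ^ q) ^ θ * y j ^ (-d * θ)) =
          (y j ^ (a * q * (1 - θ)) * y j ^ (-d * θ)) *
          ((b i j ^ q) ^ (1 - θ) * (b i j ^ q) ^ θ) := by ring
      rw [e1, ← Real.rpow_add hyp, ← Real.rpow_add' (hbq i j) (by simp), hbal]
      simp
  have hw1 : 0 ≤ (1 - θ) * (l / r) := by
    have : 0 ≤ 1 - θ := by linarith
    positivity
  have hw2 : 0 ≤ θ * (l / q) := by positivity
  have hw : (1 - θ) * (l / r) + θ * (l / q) = 1 := by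
    have h3 : l * (1 / r - a) = 1 := by rw [← hla]; field_simp
    linear_combination h3 - l * hθa
  calc ∑ i, (∑ j, b i j ^ q) ^ (l / q)
      ≤ ∑ i, ((1 - θ) * (l / r) * U i ^ (r / q) + θ * (l / q) * W i) := by
        refine Finset.sum_le_sum fun i _ => ?_
        have h7 := Real.rpow_le_rpow (Finset.sum_nonneg fun j _ => hbq i j) (hS i)
          (by positivity : 0 ≤ l / q)
        refine h7.trans ?_
        -- The weights `(1 - θ) l / r` and `θ l / q` add up to 1 because `1/l = (1 - θ)/r + θ/q`.
        have h8 := Real.geom_mean_le_arith_mean2_weighted hw1 hw2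
          (Real.rpow_nonneg (hU0 i) (r / q)) (hW0 i) hw
        refine le_trans (le_of_eq ?_) h8
        rw [Real.mul_rpow (Real.rpow_nonneg (hU0 i) _) (Real.rpow_nonneg (hW0 i) _),
          ← Real.rpow_mul (hU0 i), ← Real.rpow_mul (hW0 i), ← Real.rpow_mul (hU0 i)]
        congr 2
        field_simp
    _ = (1 - θ) * (l / r) * ∑ i, U i ^ (r / q) + θ * (l / q) * ∑ i, W i := by
        rw [Finset.sum_add_distrib, Finset.mul_sum, Finset.mul_sum]
    _ ≤ (1 - θ) * (l / r) * 1 + θ * (l / q) * 1 := by gcongr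
    _ = 1 := by rw [mul_one, mul_one, hw]

/-! ### Summing seminorms and the removal of one variable. -/

section Abstract

variable {𝕜 : Type*} [RCLike 𝕜] {X : Type*} [AddCommGroup X] [Module 𝕜 X]

/-- The `(r,1)`-summing inequality for a seminorm `G`, the set `K` playing the role of the unit
ball: families all of whose unimodular combinations lie in `K` have `r`-summable seminorms. -/
def SummingOn (K : Set X) (G : Seminorm 𝕜 X) (r C : ℝ) : Prop :=
  ∀ (n : ℕ) (x : Fin n → X), (∀ c : Fin n → 𝕜, (∀ i, ‖c i‖ ≤ 1) → ∑ i, c i • x i ∈ K) →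
    ∑ i, G (x i) ^ r ≤ C ^ r

/-- The cotype inequality for a seminorm. -/
def CotypeOn (G : Seminorm 𝕜 X) (q κ : ℝ) : Prop :=
  ∀ (n : ℕ) (x : Fin n → X),
    (∑ i, G (x i) ^ q) ^ (1 / q) ≤ κ * √((∑ ε, G (signSum x ε) ^ 2) / 2 ^ n)

/-- The unit ball of `ℓ_p`, described through `a = 1 / p`. -/
def powBall (𝕜 : Type*) [RCLike 𝕜] (a : ℝ) (n : ℕ) : Set (Fin n → 𝕜) :=
  {x | ∃ y : Fin n → ℝ, (∀ j, 0 ≤ y j) ∧ ∑ j, y j ≤ 1 ∧ ∀ j, ‖x j‖ ≤ y j ^ a}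

/-- The families in `X` which, seen as operators on `ℓ_p`, `a = 1 / p`, map the unit ball
into `K`. -/
def opBall (𝕜 : Type*) [RCLike 𝕜] {X : Type*} [AddCommGroup X] [Module 𝕜 X] (K : Set X) (a : ℝ)
    (n : ℕ) : Set (Fin n → X) :=
  {B | ∀ x ∈ powBall 𝕜 a n, ∑ j, x j • B j ∈ K}

/-- The `ℓ_q` sum of copies of a seminorm. -/
noncomputable def lsSeminorm (G : Seminorm 𝕜 X) {q : ℝ} (hq : 1 ≤ q) (n : ℕ) :
    Seminorm 𝕜 (Fin n → X) :=
  Seminorm.of (fun B => (∑ j, G (B j) ^ q) ^ (1 / q))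
    (fun x y => by
      have h := Real.Lp_add_le_of_nonneg Finset.univ hq (f := fun j => G (x j))
        (g := fun j => G (y j)) (fun j _ => apply_nonneg G _) (fun j _ => apply_nonneg G _)
      refine le_trans ?_ h
      gcongr with j _
      exact map_add_le_add G _ _)
    (fun c x => by
      have hq0 : q ≠ 0 := by linarith
      simp only [Pi.smul_apply, map_smul_eq_mul, Real.mul_rpow (norm_nonneg c) (apply_nonneg G _)]
      rw [← Finset.mul_sum, Real.mul_rpow (by positivity)
        (Finset.sum_nonneg fun j _ => Real.rpow_nonneg (apply_nonneg G _) _),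
        ← Real.rpow_mul (norm_nonneg c), mul_one_div_cancel hq0, Real.rpow_one])

theorem lsSeminorm_apply (G : Seminorm 𝕜 X) {q : ℝ} (hq : 1 ≤ q) {n : ℕ} (B : Fin n → X) :
    lsSeminorm G hq n B = (∑ j, G (B j) ^ q) ^ (1 / q) := rfl

theorem lsSeminorm_rpow (G : Seminorm 𝕜 X) {q : ℝ} (hq : 1 ≤ q) {n : ℕ} (B : Fin n → X) (t : ℝ) :
    lsSeminorm G hq n B ^ t = (∑ j, G (B j) ^ q) ^ (t / q) := by
  rw [lsSeminorm_apply,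
    ← Real.rpow_mul (Finset.sum_nonneg fun j _ => Real.rpow_nonneg (apply_nonneg G _) _),
    one_div_mul_eq_div]

theorem CotypeOn.mono {G : Seminorm 𝕜 X} {q q' κ : ℝ} (h : CotypeOn G q κ) (hq : 0 < q)
    (hqq : q ≤ q') : CotypeOn G q' κ := fun n x =>
  (ls_norm_anti _ (fun i => apply_nonneg G (x i)) hq hqq).trans (h n x)

theorem signSum_apply {n N : ℕ} (x : Fin N → Fin n → X) (ε : Fin N → Bool) (j : Fin n) :
    signSum x ε j = signSum (fun i => x i j) ε := by
  unfold signSum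
  rw [Finset.sum_apply]
  exact Finset.sum_congr rfl fun i _ => by split_ifs <;> simp

/-- Cotype is applied in each coordinate. Minkowski's inequality in `ℓ_{q/2}`, available since `q ≥
2`, then moves the average over signs outside the norm, so `κ` does not change. -/
theorem CotypeOn.lsSeminorm {G : Seminorm 𝕜 X} {q κ : ℝ} (h : CotypeOn G q κ) (hκ : 0 ≤ κ)
    (hq2 : 2 ≤ q) (hq : 1 ≤ q) (n : ℕ) : CotypeOn (lsSeminorm G hq n) q κ := by
  intro N x
  have hq0 : 0 < q := by linarith
  set E : Fin n → ℝ := fun j => ∑ ε : Fin N → Bool, G (signSum (fun i => x i j) ε) ^ 2 / 2 ^ N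
    with hE
  have hE0 : ∀ j, 0 ≤ E j := fun j => Finset.sum_nonneg fun ε _ => by positivity
  have h1 : ∀ j, ∑ i, G (x i j) ^ q ≤ κ ^ q * E j ^ (q / 2) := fun j => by
    have h2 := h N fun i => x i j
    rw [Finset.sum_div] at h2
    have h3 : 0 ≤ ∑ i, G (x i j) ^ q :=
      Finset.sum_nonneg fun i _ => Real.rpow_nonneg (apply_nonneg G _) _
    have h4 := Real.rpow_le_rpow (Real.rpow_nonneg h3 _) h2 hq0.le
    rw [← Real.rpow_mul h3, one_div_mul_cancel hq0.ne', Real.rpow_one,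
      Real.mul_rpow hκ (Real.sqrt_nonneg _), Real.sqrt_eq_rpow, ← Real.rpow_mul (hE0 j)] at h4
    rwa [one_div_mul_eq_div] at h4
  have h5 : ∑ i, _root_.lsSeminorm G hq n (x i) ^ q ≤ κ ^ q * ∑ j, E j ^ (q / 2) := by
    simp only [lsSeminorm_rpow, div_self hq0.ne', Real.rpow_one]
    rw [Finset.sum_comm, Finset.mul_sum]
    exact Finset.sum_le_sum fun j _ => h1 j
  have h6 := minkowski_sum (Finset.univ : Finset (Fin N → Bool))
    (h := fun ε j => G (signSum (fun i => x i j) ε) ^ 2 / 2 ^ N) (fun ε j => by positivity)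
    (t := q / 2) (by linarith)
  have h7 : ∀ ε : Fin N → Bool,
      (∑ j, (G (signSum (fun i => x i j) ε) ^ 2 / 2 ^ N) ^ (q / 2)) ^ (1 / (q / 2)) =
      _root_.lsSeminorm G hq n (signSum x ε) ^ 2 / 2 ^ N := fun ε => by
    have h8 : ∀ j, (G (signSum (fun i => x i j) ε) ^ 2 / 2 ^ N) ^ (q / 2) =
        G (signSum x ε j) ^ q / (2 ^ N) ^ (q / 2) := fun j => by
      rw [Real.div_rpow (by positivity) (by positivity), signSum_apply, ← Real.rpow_two,
        ← Real.rpow_mul (apply_nonneg G _), mul_div_cancel₀ _ two_ne_zero]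
    simp only [h8]
    rw [← Finset.sum_div, Real.div_rpow
      (Finset.sum_nonneg fun j _ => Real.rpow_nonneg (apply_nonneg G _) _) (by positivity),
      ← Real.rpow_mul (by positivity), mul_one_div_cancel (by positivity), Real.rpow_one,
      ← Real.rpow_two (_root_.lsSeminorm G hq n _), lsSeminorm_rpow, one_div_div]
  simp only [h7] at h6
  rw [← Finset.sum_div] at h6
  have hs : 0 ≤ ∑ j, E j ^ (q / 2) := Finset.sum_nonneg fun j _ => Real.rpow_nonneg (hE0 j) _
  calc (∑ i, _root_.lsSeminorm G hq n (x i) ^ q) ^ (1 / q)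
      ≤ (κ ^ q * ∑ j, E j ^ (q / 2)) ^ (1 / q) :=
        Real.rpow_le_rpow (Finset.sum_nonneg fun i _ => Real.rpow_nonneg (apply_nonneg _ _) _) h5
          (by positivity)
    _ = κ * √((∑ j, E j ^ (q / 2)) ^ (1 / (q / 2))) := by
        rw [Real.mul_rpow (by positivity) hs, ← Real.rpow_mul hκ, mul_one_div_cancel hq0.ne',
          Real.rpow_one, Real.sqrt_eq_rpow, ← Real.rpow_mul hs]
        congr 2
        field_simp
    _ ≤ _ := by gcongr

/-- Rows of a matrix over a `(r,1)`-summing seminorm of cotype `q`. -/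
theorem SummingOn.double {K : Set X} {G : Seminorm 𝕜 X} {r q C κ : ℝ} (hS : SummingOn K G r C)
    (hG : CotypeOn G q κ) (hr : 1 ≤ r) (hq : 0 < q) (hκ : 0 < κ) (hC : 0 < C) {m n : ℕ}
    (B : Fin m → Fin n → X)
    (h : ∀ (c : Fin m → 𝕜) (d : Fin n → 𝕜), (∀ i, ‖c i‖ ≤ 1) → (∀ j, ‖d j‖ ≤ 1) →
      ∑ i, ∑ j, (c i * d j) • B i j ∈ K) :
    ∑ i, (∑ j, (G (B i j) / (√2 * κ * C)) ^ q) ^ (r / q) ≤ 1 := by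
  have hr0 : 0 < r := by linarith
  set f : Fin m → (Fin n → Bool) → ℝ := fun i ε => G (signSum (B i) ε) with hf
  have hf0 : ∀ i ε, 0 ≤ f i ε := fun i ε => apply_nonneg G _
  -- For fixed column signs, the signed row sums form an admissible family.
  have h1 : ∀ ε, ∑ i, f i ε ^ r ≤ C ^ r := fun ε => by
    refine hS m _ fun c hc => ?_
    have h2 := h c (fun j => if ε j then 1 else -1) hc fun j => by split_ifs <;> simp
    convert h2 using 2 with i
    rw [signSum, Finset.smul_sum]
    refine Finset.sum_congr rfl fun j _ => ?_
    split_ifs <;> simp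
  -- Cotype bounds a row by a second moment, Kahane replaces it by a first moment, and Jensen (`r ≥
  -- 1`) by an `r`-th moment, which can be summed over `i`.
  have h2 : ∀ i, (∑ j, G (B i j) ^ q) ^ (r / q) ≤ (√2 * κ) ^ r * ((∑ ε, f i ε ^ r) / 2 ^ n) :=
    fun i => by
    have h0 : 0 ≤ ∑ j, G (B i j) ^ q :=
      Finset.sum_nonneg fun j _ => Real.rpow_nonneg (apply_nonneg G _) _
    have h3 : √((∑ ε, G (signSum (B i) ε) ^ 2) / 2 ^ n) ≤ √2 * ((∑ ε, f i ε) / 2 ^ n) := by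
      have hs : 0 ≤ ∑ ε, f i ε := Finset.sum_nonneg fun ε _ => hf0 i ε
      rw [Real.sqrt_le_left (by positivity), mul_pow, Real.sq_sqrt zero_le_two, div_pow,
        ← mul_div_assoc, div_le_div_iff₀ (by positivity) (by positivity)]
      have := mul_le_mul_of_nonneg_right (kahane_two_one G (B i))
        (by positivity : (0 : ℝ) ≤ 2 ^ n)
      linarith
    have h4 : (∑ j, G (B i j) ^ q) ^ (1 / q) ≤ √2 * κ * ((∑ ε, f i ε) / 2 ^ n) :=
      (hG n (B i)).trans ((mul_le_mul_of_nonneg_left h3 hκ.le).trans (le_of_eq (by ring)))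
    have h5 := Real.rpow_le_rpow (Real.rpow_nonneg h0 _) h4 hr0.le
    have hs : 0 ≤ ∑ ε, f i ε := Finset.sum_nonneg fun ε _ => hf0 i ε
    rw [← Real.rpow_mul h0, one_div_mul_eq_div, Real.mul_rpow (by positivity) (by positivity)] at h5
    exact h5.trans (mul_le_mul_of_nonneg_left
      (rpow_average_le (hf0 i) (by simp) (by positivity) hr) (by positivity))
  have h3 : ∑ i, (∑ j, G (B i j) ^ q) ^ (r / q) ≤ (√2 * κ * C) ^ r := by
    refine (Finset.sum_le_sum fun i _ => h2 i).trans ?_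
    rw [← Finset.mul_sum, ← Finset.sum_div, Finset.sum_comm, Real.mul_rpow (by positivity) hC.le]
    refine mul_le_mul_of_nonneg_left ?_ (by positivity)
    rw [div_le_iff₀ (by positivity)]
    refine (Finset.sum_le_sum fun ε _ => h1 ε).trans (le_of_eq ?_)
    simp [mul_comm]
  have h4 : ∀ i, (∑ j, (G (B i j) / (√2 * κ * C)) ^ q) ^ (r / q) =
      (∑ j, G (B i j) ^ q) ^ (r / q) / (√2 * κ * C) ^ r := fun i => by
    simp only [Real.div_rpow (apply_nonneg G _) (by positivity : 0 ≤ √2 * κ * C)]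
    rw [← Finset.sum_div, Real.div_rpow
      (Finset.sum_nonneg fun j _ => Real.rpow_nonneg (apply_nonneg G _) _) (by positivity),
      ← Real.rpow_mul (by positivity), mul_div_cancel₀ _ hq.ne']
  simp only [h4]
  rw [← Finset.sum_div]
  exact div_le_one_of_le₀ h3 (by positivity)

theorem mul_mem_powBall {a : ℝ} {n : ℕ} {y : Fin n → ℝ} (hy : ∀ j, 0 ≤ y j) (hy1 : ∑ j, y j ≤ 1)
    {d : Fin n → 𝕜} (hd : ∀ j, ‖d j‖ ≤ 1) :
    (fun j => d j * ((y j ^ a : ℝ) : 𝕜)) ∈ powBall 𝕜 a n :=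
  ⟨y, hy, hy1, fun j => by
    have h0 : 0 ≤ y j ^ a := Real.rpow_nonneg (hy j) a
    rw [norm_mul, RCLike.norm_ofReal, abs_of_nonneg h0]
    exact mul_le_of_le_one_left h0 (hd j)⟩

/-- The inductive step. Weighting the columns by a point of the `ℓ_p` ball keeps all contractive
double combinations in `K`, so `SummingOn.double` applies to the weighted matrix and to its
transpose. These are the two hypotheses of `mixed_sum_le_one`. -/
theorem SummingOn.opBall {K : Set X} {G : Seminorm 𝕜 X} {r q C κ a : ℝ} (hS : SummingOn K G r C)
    (hG : CotypeOn G q κ) (hr : 1 ≤ r) (hrq : r ≤ q) (hκ : 0 < κ) (hC : 0 < C) (ha : 0 ≤ a)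
    (har : 0 < 1 / r - a) (n : ℕ) (hq : 1 ≤ max q (1 / r - a)⁻¹) :
    SummingOn (opBall 𝕜 K a n) (lsSeminorm G hq n) (1 / r - a)⁻¹ (√2 * κ * C) := by
  intro m B hB
  have hr0 : 0 < r := by linarith
  have hC1 : 0 < √2 * κ * C := by positivity
  have hK : ∀ y : Fin n → ℝ, (∀ j, 0 ≤ y j) → ∑ j, y j ≤ 1 →
      ∀ (c : Fin m → 𝕜) (d : Fin n → 𝕜), (∀ i, ‖c i‖ ≤ 1) → (∀ j, ‖d j‖ ≤ 1) →
      ∑ i, ∑ j, (c i * d j) • (((y j ^ a : ℝ) : 𝕜) • B i j) ∈ K := fun y hy hy1 c d hc hd => by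
    have h1 := hB c hc _ (mul_mem_powBall (a := a) hy hy1 hd)
    convert h1 using 1
    simp only [Finset.sum_apply, Pi.smul_apply, Finset.smul_sum]
    rw [Finset.sum_comm]
    refine Finset.sum_congr rfl fun j _ => Finset.sum_congr rfl fun i _ => ?_
    simp only [smul_smul]
    congr 1
    ring
  have hGy : ∀ (y : Fin n → ℝ), (∀ j, 0 ≤ y j) → ∀ i j,
      G (((y j ^ a : ℝ) : 𝕜) • B i j) / (√2 * κ * C) = y j ^ a * (G (B i j) / (√2 * κ * C)) :=
    fun y hy i j => by
    rw [map_smul_eq_mul, RCLike.norm_ofReal, abs_of_nonneg (Real.rpow_nonneg (hy j) a),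
      mul_div_assoc]
  have key := mixed_sum_le_one (b := fun i j => G (B i j) / (√2 * κ * C))
    (fun i j => div_nonneg (apply_nonneg G _) hC1.le) hr0 hrq ha har
    (fun y hy hy1 => by
      have := hS.double hG hr (hr0.trans_le hrq) hκ hC
        (fun i j => ((y j ^ a : ℝ) : 𝕜) • B i j) (hK y hy hy1)
      simpa only [hGy y hy] using this)
    (fun y hy hy1 => by
      have := hS.double hG hr (hr0.trans_le hrq) hκ hC
        (fun j i => ((y j ^ a : ℝ) : 𝕜) • B i j) (fun d c hd hc => by
          have := hK y hy hy1 c d hc hd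
          rw [Finset.sum_comm] at this
          simpa only [mul_comm] using this)
      simpa only [hGy y hy] using this)
  set Q := max q (1 / r - a)⁻¹ with hQ
  set l := (1 / r - a)⁻¹ with hl
  have hQ0 : 0 < Q := by linarith
  have h4 : ∀ i, (∑ j, (G (B i j) / (√2 * κ * C)) ^ Q) ^ (l / Q) =
      _root_.lsSeminorm G hq n (B i) ^ l / (√2 * κ * C) ^ l := fun i => by
    rw [lsSeminorm_rpow]
    simp only [Real.div_rpow (apply_nonneg G _) hC1.le]
    rw [← Finset.sum_div, Real.div_rpow
      (Finset.sum_nonneg fun j _ => Real.rpow_nonneg (apply_nonneg G _) _) (by positivity),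
      ← Real.rpow_mul hC1.le, mul_div_cancel₀ _ hQ0.ne']
  simp only [h4] at key
  rwa [← Finset.sum_div, div_le_one (by positivity)] at key

end Abstract

/-! ### Mixed norms and the induction on the number of variables. -/

theorem lsNorm_nonneg (s : ℝ≥0∞) {n : ℕ} (a : Fin n → ℝ) : 0 ≤ lsNorm s a := by
  unfold lsNorm
  split_ifs
  · exact Real.iSup_nonneg fun i => abs_nonneg _
  · positivity

theorem mixedNorm_nonneg {n : ℕ} (m : ℕ) (s : Fin m → ℝ≥0∞) (a : (Fin m → Fin n) → ℝ) :
    0 ≤ mixedNorm m s a := by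
  cases m with
  | zero => exact abs_nonneg _
  | succ m => exact lsNorm_nonneg _ _

theorem lsNorm_abs (s : ℝ≥0∞) {n : ℕ} (a : Fin n → ℝ) :
    lsNorm s (fun j => |a j|) = lsNorm s a := by
  simp [lsNorm]

/-- The recursion in `mixedNorm` peels off the outermost index, whereas the induction removes the
innermost one. -/
theorem mixedNorm_snoc {n : ℕ} (m : ℕ) (s : Fin (m + 1) → ℝ≥0∞) (a : (Fin (m + 1) → Fin n) → ℝ) :
    mixedNorm (m + 1) s a = mixedNorm m (fun k => s k.castSucc) fun J =>
      lsNorm (s (Fin.last m)) fun j => a (Fin.snoc (α := fun _ => Fin n) J j) := by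
  induction m with
  | zero =>
    simp only [mixedNorm]
    rw [abs_of_nonneg (lsNorm_nonneg _ _), lsNorm_abs]
    congr 1
    funext j
    congr 1
    funext i
    rw [show i = 0 from Fin.ext (by omega), Fin.cons_zero]
    simp [Fin.snoc]
  | succ m ih =>
    rw [mixedNorm, mixedNorm]
    congr 1
    funext j
    rw [ih]
    congr 1
    funext J
    congr 1
    funext i
    rw [Fin.cons_snoc_eq_snoc_cons]

theorem lsNorm_inv_ofReal {u : ℝ} (hu : 0 < u) {n : ℕ} (b : Fin n → ℝ) :
    lsNorm (ENNReal.ofReal u)⁻¹ b = (∑ i, |b i| ^ u⁻¹) ^ (1 / u⁻¹) := by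
  rw [lsNorm, if_neg (by simp [hu]), ENNReal.toReal_inv, ENNReal.toReal_ofReal hu.le]

theorem sum_Ici_castSucc {m : ℕ} (a : Fin (m + 1) → ℝ) (k : Fin m) :
    ∑ j ∈ Finset.Ici k.castSucc, a j = ∑ j ∈ Finset.Ici k, a j.castSucc + a (Fin.last m) := by
  have h1 : Finset.Ici k.castSucc = Finset.univ.filter (k.castSucc ≤ ·) := by ext; simp
  have h2 : Finset.Ici k = Finset.univ.filter (k ≤ ·) := by ext; simp
  rw [h1, h2, Finset.sum_filter, Finset.sum_filter, Fin.sum_univ_castSucc]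
  simp [Fin.le_last]

theorem sum_Ici_succ {m : ℕ} (a : Fin (m + 1) → ℝ) (k : Fin m) :
    ∑ j ∈ Finset.Ici k.succ, a j = ∑ j ∈ Finset.Ici k, a j.succ := by
  have h1 : Finset.Ici k.succ = Finset.univ.filter (k.succ ≤ ·) := by ext; simp
  have h2 : Finset.Ici k = Finset.univ.filter (k ≤ ·) := by ext; simp
  rw [h1, h2, Finset.sum_filter, Finset.sum_filter, Fin.sum_univ_succ]
  simp

/-- The exponents `1 / min (1 / q) (1 / r - (a_k + ⋯ + a_m))`. -/
noncomputable def tailExponent {m : ℕ} (a : Fin m → ℝ) (r q : ℝ) (k : Fin m) : ℝ≥0∞ :=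
  (ENNReal.ofReal (min (1 / q) (1 / r - ∑ j ∈ Finset.Ici k, a j)))⁻¹

/-- The exponents follow the inductive step: dropping the last variable replaces `(r, q)` by `(l,
max q l)`. -/
theorem tailExponent_castSucc {m : ℕ} {a : Fin (m + 1) → ℝ} (ha : ∀ k, 0 ≤ a k) {r q : ℝ}
    (hq : 0 < q) (har : 0 < 1 / r - a (Fin.last m)) (k : Fin m) :
    tailExponent a r q k.castSucc = tailExponent (fun j => a j.castSucc)
      (1 / r - a (Fin.last m))⁻¹ (max q (1 / r - a (Fin.last m))⁻¹) k := by
  unfold tailExponent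
  rw [sum_Ici_castSucc]
  have h0 : 0 ≤ ∑ j ∈ Finset.Ici k, a j.castSucc := Finset.sum_nonneg fun j _ => ha _
  have h1 : 1 / max q (1 / r - a (Fin.last m))⁻¹ = min (1 / q) (1 / r - a (Fin.last m)) := by
    rcases le_total q (1 / r - a (Fin.last m))⁻¹ with h | h
    · rw [max_eq_right h, min_eq_right, one_div, inv_inv]
      rw [one_div q]; exact (le_inv_comm₀ hq har).1 h
    · rw [max_eq_left h, min_eq_left]
      rw [one_div q]; exact (inv_le_comm₀ har hq).1 h
  rw [h1, one_div (1 / r - a (Fin.last m))⁻¹, inv_inv, min_assoc]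
  congr 3
  rw [min_eq_right (by linarith)]
  ring

theorem lsNorm_tailExponent_last {m n : ℕ} {a : Fin (m + 1) → ℝ} {r q : ℝ}
    (hq : 0 < q) (har : 0 < 1 / r - a (Fin.last m)) (b : Fin n → ℝ) :
    lsNorm (tailExponent a r q (Fin.last m)) b =
      (∑ i, |b i| ^ max q (1 / r - a (Fin.last m))⁻¹) ^
        (1 / max q (1 / r - a (Fin.last m))⁻¹) := by
  have h1 : (min (1 / q) (1 / r - a (Fin.last m)))⁻¹ = max q (1 / r - a (Fin.last m))⁻¹ := by
    rcases le_total (1 / q) (1 / r - a (Fin.last m)) with h | h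
    · rw [min_eq_left h, max_eq_left, one_div, inv_inv]
      rw [one_div q] at h; exact (inv_le_comm₀ hq har).1 h
    · rw [min_eq_right h, max_eq_right]
      rw [one_div q] at h; exact (le_inv_comm₀ har hq).1 h
  have h2 : Finset.Ici (Fin.last m) = {Fin.last m} := by ext; simp [Fin.last_le_iff]
  rw [tailExponent, h2, Finset.sum_singleton, lsNorm_inv_ofReal (lt_min (by positivity) har), h1]

universe u

/-- Everything about `X` is quantified inside the induction, because the step passes to `Fin n → X`
with the ball `opBall` and the seminorm `lsSeminorm`. The strict bound on `∑ k, a k` keeps every new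
`1/l` positive. -/
theorem mixedNorm_le_of_summingOn {𝕜 : Type*} [RCLike 𝕜] (m : ℕ) :
    ∀ {X : Type u} [AddCommGroup X] [Module 𝕜 X] {K : Set X} {G : Seminorm 𝕜 X} {r q C κ : ℝ}
      {a : Fin m → ℝ}, (∀ (c : 𝕜) (x : X), ‖c‖ ≤ 1 → x ∈ K → c • x ∈ K) → SummingOn K G r C →
      CotypeOn G q κ → 1 ≤ r → r ≤ q → 2 ≤ q → 0 < κ → 0 < C → (∀ k, 0 ≤ a k) →
      ∑ k, a k < 1 / r → ∀ {n : ℕ} (A : (Fin m → Fin n) → X),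
      (∀ x : Fin m → Fin n → 𝕜, (∀ k, x k ∈ powBall 𝕜 (a k) n) →
        ∑ J, (∏ k, x k (J k)) • A J ∈ K) →
      mixedNorm m (tailExponent a r q) (fun J => G (A J)) ≤ (√2 * κ) ^ m * C := by
  induction m with
  | zero =>
    intro X _ _ K G r q C κ a hK hS hG hr hrq hq hκ hC ha har n A hA
    rw [mixedNorm, abs_of_nonneg (apply_nonneg G _), pow_zero, one_mul]
    have h1 := hS 1 (fun _ => A Fin.elim0) fun c hc => by
      have h2 := hA (fun k => k.elim0) fun k => k.elim0
      rw [Fin.sum_univ_one]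
      refine hK _ _ (hc 0) ?_
      convert h2 using 1
      simp only [Finset.univ_eq_empty, Finset.prod_empty, one_smul, Finset.univ_unique,
        Finset.sum_singleton]
      exact congrArg A (Subsingleton.elim _ _)
    rw [Fin.sum_univ_one] at h1
    exact (Real.rpow_le_rpow_iff (apply_nonneg G _) hC.le (by linarith)).1 h1
  | succ m ih =>
    intro X _ _ K G r q C κ a hK hS hG hr hrq hq hκ hC ha har n A hA
    rw [Fin.sum_univ_castSucc] at har
    have hs : 0 ≤ ∑ k : Fin m, a k.castSucc := Finset.sum_nonneg fun k _ => ha _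
    have har' : 0 < 1 / r - a (Fin.last m) := by linarith
    have hr0 : 0 < r := by linarith
    set l := (1 / r - a (Fin.last m))⁻¹ with hl
    have hrl : r ≤ l := by
      rw [hl, le_inv_comm₀ hr0 har', ← one_div]
      linarith [ha (Fin.last m)]
    have hqQ : q ≤ max q l := le_max_left _ _
    have hQ1 : 1 ≤ max q l := by linarith
    have hS' := hS.opBall hG hr hrq hκ hC (ha _) har' n hQ1
    have hG' := (hG.mono (by linarith) hqQ).lsSeminorm hκ.le (by linarith) hQ1 n
    have h := ih (K := opBall 𝕜 K (a (Fin.last m)) n) (G := lsSeminorm G hQ1 n) (r := l)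
      (q := max q l) (C := √2 * κ * C) (κ := κ) (a := fun k => a k.castSucc)
      (fun c B hc hB x hx => by
        have := hK c _ hc (hB x hx)
        rw [Finset.smul_sum] at this
        simpa only [Pi.smul_apply, smul_comm c] using this)
      hS' hG' (by linarith) (le_max_right _ _) (by linarith) hκ (by positivity)
      (fun k => ha _) (by rw [hl, one_div, inv_inv]; linarith)
      (fun J j => A (Fin.snoc (α := fun _ => Fin n) J j))
      (fun x hx y hy => by
        have h1 := hA (Fin.snoc (α := fun _ => Fin n → 𝕜) x y) fun k => by
          refine Fin.lastCases ?_ (fun k => ?_) k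
          · simpa using hy
          · simpa using hx k
        rw [← (Fin.snocEquiv fun _ : Fin (m + 1) => Fin n).sum_comp,
          Fintype.sum_prod_type] at h1
        convert h1 using 1
        refine Finset.sum_congr rfl fun j _ => ?_
        rw [Finset.sum_apply, Finset.smul_sum]
        refine Finset.sum_congr rfl fun J _ => ?_
        simp only [Pi.smul_apply, smul_smul, Fin.snocEquiv, Equiv.coe_fn_mk]
        rw [Fin.prod_univ_castSucc]
        simp [mul_comm])
    rw [mixedNorm_snoc]
    refine le_trans (le_of_eq ?_) (h.trans (le_of_eq (by ring)))
    congr 1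
    · funext k
      exact tailExponent_castSucc ha (by linarith) har' k
    · funext J
      rw [lsNorm_tailExponent_last (by linarith) har', lsSeminorm_apply]
      simp only [abs_of_nonneg (apply_nonneg G _), hl]

/-! ### From operators to the abstract setting; the upper bound. -/

section Operators

variable {𝕜 : Type*} [RCLike 𝕜]
  {E : Type*} [NormedAddCommGroup E] [NormedSpace 𝕜 E]
  {F : Type*} [NormedAddCommGroup F] [NormedSpace 𝕜 F]

theorem weakL1Norm_nonneg {n : ℕ} (x : Fin n → E) : 0 ≤ weakL1Norm 𝕜 x :=
  Real.iSup_nonneg fun _ => Finset.sum_nonneg fun _ _ => norm_nonneg _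

theorem weakL1Norm_le {n : ℕ} {x : Fin n → E} {D : ℝ} (hD : 0 ≤ D)
    (h : ∀ c : Fin n → 𝕜, (∀ i, ‖c i‖ ≤ 1) → ‖∑ i, c i • x i‖ ≤ D) : weakL1Norm 𝕜 x ≤ D := by
  refine Real.iSup_le (fun φ => ?_) hD
  choose c hc1 hc using fun i => RCLike.exists_norm_eq_mul_self ((φ : StrongDual 𝕜 E) (x i))
  have h1 : ((∑ i, ‖(φ : StrongDual 𝕜 E) (x i)‖ : ℝ) : 𝕜) = (φ : StrongDual 𝕜 E) (∑ i, c i • x i) := by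
    rw [RCLike.ofReal_sum, map_sum]
    exact Finset.sum_congr rfl fun i _ => by rw [hc, map_smul, smul_eq_mul]
  have h2 : 0 ≤ ∑ i, ‖(φ : StrongDual 𝕜 E) (x i)‖ := Finset.sum_nonneg fun i _ => norm_nonneg _
  calc ∑ i, ‖(φ : StrongDual 𝕜 E) (x i)‖
      = ‖(φ : StrongDual 𝕜 E) (∑ i, c i • x i)‖ := by
        rw [← h1, RCLike.norm_ofReal, abs_of_nonneg h2]
    _ ≤ 1 * D := ContinuousLinearMap.le_of_opNorm_le_of_le _ (mem_closedBall_zero_iff.1 φ.2)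
        (h c fun i => (hc1 i).le)
    _ = D := one_mul D

/-- Hahn–Banach: a norming functional of the combination attains the bound. -/
theorem norm_sum_smul_le_weakL1Norm {n : ℕ} (x : Fin n → E) {c : Fin n → 𝕜}
    (hc : ∀ i, ‖c i‖ ≤ 1) : ‖∑ i, c i • x i‖ ≤ weakL1Norm 𝕜 x := by
  obtain ⟨φ, hφ, hφx⟩ := exists_dual_vector'' 𝕜 (∑ i, c i • x i)
  have hb : BddAbove (Set.range fun φ : Metric.closedBall (0 : StrongDual 𝕜 E) 1 =>
      ∑ i, ‖(φ : StrongDual 𝕜 E) (x i)‖) := by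
    refine ⟨∑ i, ‖x i‖, ?_⟩
    rintro _ ⟨ψ, rfl⟩
    refine Finset.sum_le_sum fun i _ => ?_
    exact (ContinuousLinearMap.le_of_opNorm_le _ (mem_closedBall_zero_iff.1 ψ.2) _).trans
      (one_mul _).le
  refine le_trans ?_ (le_ciSup hb ⟨φ, mem_closedBall_zero_iff.2 hφ⟩)
  have h1 : ‖∑ i, c i • x i‖ = ‖φ (∑ i, c i • x i)‖ := by
    rw [hφx, RCLike.norm_ofReal, abs_of_nonneg (norm_nonneg _)]
  rw [h1, map_sum]
  refine norm_sum_le_of_le _ fun i _ => ?_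
  rw [map_smul, norm_smul]
  exact mul_le_of_le_one_left (norm_nonneg _) (hc i)

theorem IsSummingWith.summingOn {r c D : ℝ} {v : E →L[𝕜] F} (hv : IsSummingWith r v c)
    (hr : 0 < r) (hc : 0 ≤ c) (hD : 0 ≤ D) :
    SummingOn (𝕜 := 𝕜) (Metric.closedBall (0 : E) D) ((normSeminorm 𝕜 F).comp v.toLinearMap) r
      (c * D) := fun n x hx => by
  have h1 := (hv n x).trans (mul_le_mul_of_nonneg_left
    (weakL1Norm_le hD fun c hc => mem_closedBall_zero_iff.1 (hx c hc)) hc)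
  have h0 : 0 ≤ ∑ i, ‖v (x i)‖ ^ r := Finset.sum_nonneg fun i _ => by positivity
  have h2 := Real.rpow_le_rpow (by positivity) h1 hr.le
  rwa [← Real.rpow_mul h0, one_div_mul_cancel hr.ne', Real.rpow_one] at h2

theorem HasCotypeWith.cotypeOn {q κ κ' : ℝ} (h : HasCotypeWith F q κ) (hκ : κ ≤ κ')
    (v : E →L[𝕜] F) : CotypeOn ((normSeminorm 𝕜 F).comp v.toLinearMap) q κ' := fun n x => by
  have h1 := h n fun i => v (x i)
  have h2 : ∀ ε : Fin n → Bool, (normSeminorm 𝕜 F).comp v.toLinearMap (signSum x ε) =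
      ‖∑ i, if ε i then v (x i) else -v (x i)‖ := fun ε => by
    simp only [Seminorm.comp_apply, coe_normSeminorm, signSum]
    congr 1
    simp [map_sum, apply_ite v]
  simp only [h2]
  exact h1.trans (mul_le_mul_of_nonneg_right hκ (Real.sqrt_nonneg _))

theorem norm_toLp_le_one {p : ℝ≥0∞} [hp : Fact (1 ≤ p)] {n : ℕ} {x : Fin n → 𝕜}
    (hx : x ∈ powBall 𝕜 p⁻¹.toReal n) : ‖(WithLp.toLp p x : PiLp p fun _ : Fin n => 𝕜)‖ ≤ 1 := by
  obtain ⟨y, hy, hy1, hxy⟩ := hx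
  rcases eq_or_ne p ∞ with rfl | hp'
  · rw [PiLp.norm_eq_ciSup]
    exact Real.iSup_le (fun i => by simpa using hxy i) zero_le_one
  · have hp0 : 0 < p.toReal := ENNReal.toReal_pos (zero_lt_one.trans_le hp.out).ne' hp'
    rw [PiLp.norm_eq_sum hp0]
    refine Real.rpow_le_one (by positivity) (le_trans (Finset.sum_le_sum fun i _ => ?_) hy1)
      (by positivity)
    have h := Real.rpow_le_rpow (norm_nonneg _) (hxy i) hp0.le
    rwa [← Real.rpow_mul (hy i), ENNReal.toReal_inv, inv_mul_cancel₀ hp0.ne', Real.rpow_one] at h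

theorem toLp_eq_sum_single (p : ℝ≥0∞) {n : ℕ} (x : Fin n → 𝕜) :
    (WithLp.toLp p x : PiLp p fun _ : Fin n => 𝕜) = ∑ j, x j • PiLp.single p j (1 : 𝕜) := by
  ext i
  simp [Pi.single_apply]

theorem ContinuousMultilinearMap.apply_toLp {m n : ℕ} {p : Fin m → ℝ≥0∞}
    (A : ContinuousMultilinearMap 𝕜 (fun j : Fin m => PiLp (p j) fun _ : Fin n => 𝕜) E)
    (x : Fin m → Fin n → 𝕜) :
    A (fun k => WithLp.toLp (p k) (x k)) =
      ∑ J : Fin m → Fin n, (∏ k, x k (J k)) • A fun k => PiLp.single (p k) (J k) (1 : 𝕜) := by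
  simp only [toLp_eq_sum_single]
  rw [A.map_sum]
  exact Finset.sum_congr rfl fun J _ => A.map_smul_univ _ _

end Operators

theorem critExponent_zero {m : ℕ} {hm : 2 ≤ m + 1} {p : Fin (m + 1) → ℝ≥0∞} {r q : ℝ}
    {k₀ : Fin (m + 1)} (h : IsCritical hm p r q k₀) : critExponent p r q k₀ 0 = ∞ := by
  have h1 : tailSum p 0 = 1 / r := by
    rw [← h.sum_eq, tailSum]
    congr 1
    ext j
    simp
  rw [critExponent, if_pos (Fin.zero_le _), h1]
  simp

theorem tailSum_anti {m : ℕ} (p : Fin m → ℝ≥0∞) {k l : Fin m} (hkl : k ≤ l) :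
    tailSum p l ≤ tailSum p k :=
  Finset.sum_le_sum_of_subset_of_nonneg (Finset.Ici_subset_Ici.2 hkl)
    fun _ _ _ => ENNReal.toReal_nonneg

/-- Tail sums decrease in `k`, so `k ≤ k₀` holds exactly when `1/r - tailSum p k ≤ 1/q`. The case
distinction is therefore a minimum. -/
theorem critExponent_eq {m : ℕ} {hm : 2 ≤ m} {p : Fin m → ℝ≥0∞} {r q : ℝ} {k₀ : Fin m}
    (h : IsCritical hm p r q k₀) (k : Fin m) :
    critExponent p r q k₀ k = (ENNReal.ofReal (min (1 / q) (1 / r - tailSum p k)))⁻¹ := by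
  have hq : 0 < q := by linarith [h.two_le_q]
  unfold critExponent
  split_ifs with hk
  · rw [min_eq_right]
    have := h.isGreatest.1
    simp only [Set.mem_ofPred_eq] at this
    linarith [tailSum_anti p hk]
  · have h1 : tailSum p k < 1 / r - 1 / q := by
      by_contra hc
      exact hk (h.isGreatest.2 (not_lt.1 hc))
    rw [min_eq_left (by linarith), one_div, ENNReal.ofReal_inv_of_pos hq, inv_inv]

theorem tailSum_succ {m : ℕ} (p : Fin (m + 1) → ℝ≥0∞) (k : Fin m) :
    tailSum p k.succ = ∑ j ∈ Finset.Ici k, (p j.succ)⁻¹.toReal :=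
  sum_Ici_succ (fun j => (p j)⁻¹.toReal) k

theorem tailSum_one {m : ℕ} (hm : 2 ≤ m + 1) (p : Fin (m + 1) → ℝ≥0∞) :
    tailSum p ⟨1, hm⟩ = ∑ j : Fin m, (p j.succ)⁻¹.toReal := by
  have h : (⟨1, hm⟩ : Fin (m + 1)) = Fin.succ ⟨0, by omega⟩ := rfl
  rw [h, tailSum_succ]
  congr 1
  ext j
  simp [Fin.le_def]

theorem mixedNorm_critExponent_le {𝕜 : Type*} [RCLike 𝕜] {m : ℕ} {hm : 2 ≤ m + 1}
    {p : Fin (m + 1) → ℝ≥0∞} [∀ j, Fact (1 ≤ p j)] {r q κ c D : ℝ} {k₀ : Fin (m + 1)}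
    (hcrit : IsCritical hm p r q k₀)
    {E : Type*} [NormedAddCommGroup E] [NormedSpace 𝕜 E]
    {F : Type*} [NormedAddCommGroup F] [NormedSpace 𝕜 F]
    (hF : HasCotypeWith F q κ) {v : E →L[𝕜] F} (hv : IsSummingWith r v c) (hc : 0 < c) {n : ℕ}
    (A : ContinuousMultilinearMap 𝕜 (fun j : Fin (m + 1) => PiLp (p j) fun _ : Fin n => 𝕜) E)
    (hD : 0 < D) (hA : ‖A‖ ≤ D) :
    mixedNorm (m + 1) (critExponent p r q k₀) (coeffArray v A) ≤
      (√2 * max κ 1) ^ m * (c * D) := by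
  have hr : 0 < r := by linarith [hcrit.one_le_r]
  have hs0 : critExponent p r q k₀ 0 = ∞ := critExponent_zero hcrit
  rw [mixedNorm, lsNorm, if_pos hs0]
  refine Real.iSup_le (fun i => ?_) (by positivity)
  rw [abs_of_nonneg (mixedNorm_nonneg _ _ _)]
  have key := mixedNorm_le_of_summingOn m (a := fun k => (p k.succ)⁻¹.toReal)
    (fun (c : 𝕜) x hc hx => by
      rw [mem_closedBall_zero_iff] at hx ⊢
      rw [norm_smul]
      exact (mul_le_of_le_one_left (norm_nonneg x) hc).trans hx)
    (hv.summingOn hr hc.le hD.le) (hF.cotypeOn (le_max_left κ 1) v) hcrit.one_le_r hcrit.r_le_q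
    hcrit.two_le_q (by positivity) (by positivity) (fun k => ENNReal.toReal_nonneg)
    (by rw [← tailSum_one hm]; exact hcrit.tail_lt)
    (fun J : Fin m → Fin n =>
      A fun k => PiLp.single (p k) ((Fin.cons i J : Fin (m + 1) → Fin n) k) (1 : 𝕜))
    (fun x hx => by
      rw [mem_closedBall_zero_iff]
      -- Freezing the first variable at `e_i`, a point of its unit ball, leaves a form bounded by
      -- `D` on the product of the other balls.
      have h1 := A.apply_toLp (Fin.cons (Pi.single i 1) x)
      rw [← (Fin.consEquiv fun _ : Fin (m + 1) => Fin n).sum_comp, Fintype.sum_prod_type,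
        Finset.sum_eq_single i (fun j _ hj => by
          simp [Fin.consEquiv, Fin.prod_univ_succ, Pi.single_eq_of_ne hj]) (by simp)] at h1
      simp only [Fin.consEquiv, Equiv.coe_fn_mk, Fin.prod_univ_succ, Fin.cons_zero,
        Fin.cons_succ, Pi.single_eq_same, one_mul] at h1
      rw [← h1]
      refine (A.le_opNorm_mul_prod_of_le (b := fun _ => 1) fun k => ?_).trans (by simpa using hA)
      refine Fin.cases ?_ (fun k => ?_) k
      · rw [Fin.cons_zero]
        refine norm_toLp_le_one ⟨Pi.single i 1, fun j => ?_, by simp, fun j => ?_⟩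
        · by_cases hj : j = i
          · subst hj; simp
          · simp [Pi.single_eq_of_ne hj]
        · by_cases hj : j = i
          · subst hj; simp
          · rw [Pi.single_eq_of_ne hj, Pi.single_eq_of_ne hj, norm_zero]
            positivity
      · rw [Fin.cons_succ]
        exact norm_toLp_le_one (hx k))
  refine le_trans (le_of_eq ?_) key
  congr 1
  funext k
  rw [Fin.tail, critExponent_eq hcrit, tailSum_succ, tailExponent]

/-- The abstract estimate needs positive constants, so `c` and `‖A‖` are enlarged by `δ → 0` before
the infimum over `c` is taken. -/
theorem mixedNorm_critExponent_le_summingNorm {𝕜 : Type*} [RCLike 𝕜] {m : ℕ} {hm : 2 ≤ m + 1}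
    {p : Fin (m + 1) → ℝ≥0∞} [∀ j, Fact (1 ≤ p j)] {r q κ : ℝ} {k₀ : Fin (m + 1)}
    (hcrit : IsCritical hm p r q k₀)
    {E : Type*} [NormedAddCommGroup E] [NormedSpace 𝕜 E]
    {F : Type*} [NormedAddCommGroup F] [NormedSpace 𝕜 F]
    (hF : HasCotypeWith F q κ) {v : E →L[𝕜] F} (hv : IsAbsSumming r v) {n : ℕ}
    (A : ContinuousMultilinearMap 𝕜 (fun j : Fin (m + 1) => PiLp (p j) fun _ : Fin n => 𝕜) E) :
    mixedNorm (m + 1) (critExponent p r q k₀) (coeffArray v A) ≤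
      (√2 * max κ 1) ^ m * ‖A‖ * summingNorm r v := by
  set M := mixedNorm (m + 1) (critExponent p r q k₀) (coeffArray v A)
  have h1 : ∀ c, 0 ≤ c → IsSummingWith r v c → M ≤ (√2 * max κ 1) ^ m * (c * ‖A‖) :=
    fun c hc hvc => by
    have ht : Filter.Tendsto (fun δ : ℝ => (√2 * max κ 1) ^ m * ((c + δ) * (‖A‖ + δ)))
        (nhdsWithin 0 (Set.Ioi 0)) (nhds ((√2 * max κ 1) ^ m * ((c + 0) * (‖A‖ + 0)))) := by
      refine Filter.Tendsto.mono_left ?_ nhdsWithin_le_nhds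
      exact Continuous.tendsto (by fun_prop) 0
    rw [add_zero, add_zero] at ht
    refine ge_of_tendsto ht (eventually_mem_nhdsWithin.mono fun δ hδ => ?_)
    have hδ0 : (0 : ℝ) < δ := hδ
    refine mixedNorm_critExponent_le hcrit hF (fun N x => (hvc N x).trans ?_) (by positivity) A
      (by positivity) (by linarith)
    exact mul_le_mul_of_nonneg_right (by linarith) (weakL1Norm_nonneg x)
  obtain ⟨c₀, hc₀⟩ := hv
  have hne : {C : ℝ | 0 ≤ C ∧ IsSummingWith r v C}.Nonempty :=
    ⟨max c₀ 0, le_max_right _ _, fun N x => (hc₀ N x).trans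
      (mul_le_mul_of_nonneg_right (le_max_left _ _) (weakL1Norm_nonneg x))⟩
  have hK : 0 ≤ (√2 * max κ 1) ^ m * ‖A‖ := by positivity
  -- Passing to the infimum divides by this factor, so its vanishing is treated apart.
  rcases hK.eq_or_lt with h0 | hpos
  · obtain ⟨c, hc, hvc⟩ := hne
    have := h1 c hc hvc
    rw [← h0, zero_mul]
    nlinarith
  · rw [← div_le_iff₀' hpos]
    refine le_csInf hne fun c ⟨hc, hvc⟩ => ?_
    rw [div_le_iff₀' hpos]
    linarith [h1 c hc hvc]

/-! ### Sharpness: inclusions of sequence spaces and diagonal operators. -/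

theorem SummingOn.opBall_of_eq {𝕜 : Type*} [RCLike 𝕜] {X : Type*} [AddCommGroup X] [Module 𝕜 X]
    {K : Set X} {G : Seminorm 𝕜 X} {r q C κ a l Q : ℝ}
    (hS : SummingOn K G r C) (hG : CotypeOn G q κ) (hr : 1 ≤ r) (hrq : r ≤ q) (hκ : 0 < κ)
    (hC : 0 < C) (ha : 0 ≤ a) (har : 0 < 1 / r - a) (n : ℕ) (hl : (1 / r - a)⁻¹ = l)
    (hQ : max q l = Q) (hq : 1 ≤ Q) :
    SummingOn (_root_.opBall 𝕜 K a n) (lsSeminorm G hq n) l (√2 * κ * C) := by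
  subst hl hQ
  exact hS.opBall hG hr hrq hκ hC ha har n hq

theorem mem_powBall_of_norm_le_one {𝕜 : Type*} [RCLike 𝕜] {p : ℝ≥0∞} [hp : Fact (1 ≤ p)] {n : ℕ}
    {x : PiLp p fun _ : Fin n => 𝕜} (hx : ‖x‖ ≤ 1) : (fun j => x j) ∈ powBall 𝕜 p⁻¹.toReal n := by
  rcases eq_or_ne p ∞ with rfl | hp'
  -- For `p = ∞` the exponent is 0 and `0 ^ 0 = 1`, so the zero weight already yields the bound 1.
  · refine ⟨fun _ => 0, fun _ => le_rfl, by simp, fun j => ?_⟩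
    simpa using (PiLp.norm_apply_le x j).trans hx
  · have hp0 : 0 < p.toReal := ENNReal.toReal_pos (zero_lt_one.trans_le hp.out).ne' hp'
    refine ⟨fun j => ‖x j‖ ^ p.toReal, fun j => by positivity, ?_, fun j => ?_⟩
    · rw [PiLp.norm_eq_sum hp0] at hx
      by_contra hc
      exact (Real.one_lt_rpow (not_le.1 hc) (by positivity : 0 < 1 / p.toReal)).not_ge hx
    · rw [← Real.rpow_mul (norm_nonneg _), ENNReal.toReal_inv, mul_inv_cancel₀ hp0.ne',
        Real.rpow_one]

/-- The generalized Hölder inequality on unit balls. -/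
theorem sum_prod_rpow_le_one {𝕜 : Type*} [RCLike 𝕜] {m n : ℕ} {a : Fin m → ℝ} {r : ℝ} (hr : 0 < r)
    (ha : ∀ k, 0 ≤ a k) (har : ∑ k, a k = 1 / r) {x : Fin m → Fin n → 𝕜}
    (hx : ∀ k, x k ∈ powBall 𝕜 (a k) n) : ∑ j, ‖∏ k, x k j‖ ^ r ≤ 1 := by
  choose y hy hy1 hxy using hx
  have hw : ∑ k, a k * r = 1 := by rw [← Finset.sum_mul, har, one_div_mul_cancel hr.ne']
  calc ∑ j, ‖∏ k, x k j‖ ^ r ≤ ∑ j, ∑ k, a k * r * y k j := by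
        refine Finset.sum_le_sum fun j _ => ?_
        have h1 := Real.geom_mean_le_arith_mean_weighted Finset.univ (fun k => a k * r)
          (fun k => y k j) (fun k _ => mul_nonneg (ha k) hr.le) hw (fun k _ => hy k j)
        refine le_trans ?_ h1
        rw [norm_prod, ← Real.finsetProd_rpow _ _ fun k _ => norm_nonneg _]
        refine Finset.prod_le_prod (fun k _ => by positivity) fun k _ => ?_
        rw [Real.rpow_mul (hy k j)]
        exact Real.rpow_le_rpow (norm_nonneg _) (hxy k j) hr.le
    _ = ∑ k, a k * r * ∑ j, y k j := by
        rw [Finset.sum_comm]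
        simp only [Finset.mul_sum]
    _ ≤ ∑ k, a k * r * 1 := Finset.sum_le_sum fun k _ =>
        mul_le_mul_of_nonneg_left (hy1 k) (mul_nonneg (ha k) hr.le)
    _ = 1 := by simpa using hw

theorem abs_le_lsNorm {s : ℝ≥0∞} (hs : s ≠ 0) {n : ℕ} (a : Fin n → ℝ) (i : Fin n) :
    |a i| ≤ lsNorm s a := by
  unfold lsNorm
  split_ifs with h
  · exact le_ciSup (f := fun i => |a i|) (Set.finite_range _).bddAbove i
  · have hs0 : 0 < s.toReal := ENNReal.toReal_pos hs h
    have h1 : |a i| ^ s.toReal ≤ ∑ i, |a i| ^ s.toReal :=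
      Finset.single_le_sum (f := fun i => |a i| ^ s.toReal) (fun j _ => by positivity)
        (Finset.mem_univ i)
    have h2 := Real.rpow_le_rpow (by positivity) h1 (by positivity : 0 ≤ 1 / s.toReal)
    rwa [← Real.rpow_mul (abs_nonneg _), mul_one_div_cancel hs0.ne', Real.rpow_one] at h2

theorem abs_le_mixedNorm {n m : ℕ} {s : Fin m → ℝ≥0∞} (hs : ∀ k, s k ≠ 0)
    (a : (Fin m → Fin n) → ℝ) (J : Fin m → Fin n) : |a J| ≤ mixedNorm m s a := by
  induction m with
  | zero => rw [mixedNorm, Subsingleton.elim J Fin.elim0]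
  | succ m ih =>
    rw [mixedNorm]
    refine le_trans ?_ (abs_le_lsNorm (hs 0) _ (J 0))
    refine le_trans ?_ (le_abs_self _)
    have := ih (s := Fin.tail s) (fun k => hs k.succ) (fun J' => a (Fin.cons (J 0) J')) (Fin.tail J)
    simpa only [Fin.cons_self_tail] using this

/-- Each inner mixed norm dominates its diagonal entry, so the outer sum has `n` terms that are at
least 1. -/
theorem rpow_le_mixedNorm {n m : ℕ} {s : Fin (m + 1) → ℝ≥0∞} (hs : ∀ k, s k ≠ 0) {t : ℝ}
    (ht : 0 < t) (h0 : s 0 = ENNReal.ofReal t) (a : (Fin (m + 1) → Fin n) → ℝ)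
    (ha : ∀ j, 1 ≤ |a fun _ => j|) : (n : ℝ) ^ (1 / t) ≤ mixedNorm (m + 1) s a := by
  rw [mixedNorm, lsNorm, h0, if_neg ENNReal.ofReal_ne_top, ENNReal.toReal_ofReal ht.le]
  refine Real.rpow_le_rpow (by positivity) ?_ (by positivity)
  have h1 : ∀ j : Fin n, (1 : ℝ) ≤
      |mixedNorm m (Fin.tail s) fun J => a (Fin.cons j J)| ^ t := fun j => by
    refine Real.one_le_rpow ?_ ht.le
    refine (ha j).trans (le_trans ?_ (le_abs_self _))
    have := abs_le_mixedNorm (s := Fin.tail s) (fun k => hs k.succ) (fun J => a (Fin.cons j J))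
      fun _ => j
    have e : (Fin.cons j (fun _ => j) : Fin (m + 1) → Fin n) = fun _ => j := by
      funext k; refine Fin.cases ?_ (fun k => ?_) k <;> simp
    rwa [e] at this
  simpa using Finset.sum_le_sum fun j (_ : j ∈ Finset.univ) => h1 j

section Sequence

variable {𝕜 : Type*} [RCLike 𝕜] {H : Type*} [NormedAddCommGroup H] [NormedSpace 𝕜 H]

/-- Carries inequalities for finite truncations over to the sequence spaces. -/
theorem tendsto_lsSeminorm {q : ℝ} (hq : 1 ≤ q) (f : lp (fun _ : ℕ => H) (ENNReal.ofReal q)) :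
    Filter.Tendsto (fun n => lsSeminorm (normSeminorm 𝕜 H) hq n fun j : Fin n => f j)
      Filter.atTop (nhds ‖f‖) := by
  have hq0 : 0 < q := by linarith
  have h := lp.hasSum_norm (by rwa [ENNReal.toReal_ofReal hq0.le]) f
  rw [ENNReal.toReal_ofReal hq0.le] at h
  have h1 := h.tendsto_sum_nat.rpow_const (p := 1 / q) (Or.inr (by positivity))
  have h0 : 0 ≤ ‖f‖ := lp.norm_nonneg' f
  rw [← Real.rpow_mul h0, mul_one_div_cancel hq0.ne', Real.rpow_one] at h1
  refine h1.congr fun n => ?_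
  rw [lsSeminorm_apply, ← Fin.sum_univ_eq_sum_range fun i => ‖f i‖ ^ q]
  rfl

theorem lp_signSum_apply {p : ℝ≥0∞} {n : ℕ} (x : Fin n → lp (fun _ : ℕ => H) p)
    (ε : Fin n → Bool) (j : ℕ) : signSum x ε j = signSum (fun i => x i j) ε := by
  unfold signSum
  rw [lp.coeFn_sum, Finset.sum_apply]
  refine Finset.sum_congr rfl fun i _ => ?_
  split_ifs <;> rfl

theorem hasCotypeWith_lp {q κ : ℝ} (hq2 : 2 ≤ q) (hκ : 0 ≤ κ)
    (h : CotypeOn (normSeminorm 𝕜 H) q κ) [Fact (1 ≤ ENNReal.ofReal q)] :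
    HasCotypeWith (lp (fun _ : ℕ => H) (ENNReal.ofReal q)) q κ := by
  intro N x
  have hq : 1 ≤ q := by linarith
  have h1 : ∀ n, _ := fun n => h.lsSeminorm hκ hq2 hq n N fun i (j : Fin n) => x i j
  have t1 := (tendsto_finsetSum Finset.univ fun i (_ : i ∈ Finset.univ) =>
    (tendsto_lsSeminorm (𝕜 := 𝕜) hq (x i)).rpow_const (p := q) (Or.inr (by linarith))).rpow_const
      (p := 1 / q) (Or.inr (by positivity))
  have t2 := ((tendsto_finsetSum Finset.univ fun ε (_ : ε ∈ Finset.univ) =>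
    (tendsto_lsSeminorm (𝕜 := 𝕜) hq (signSum x ε)).pow 2).div_const (2 ^ N)).sqrt.const_mul κ
  refine le_of_tendsto_of_tendsto' t1 t2 fun n => ?_
  refine (h1 n).trans (le_of_eq ?_)
  congr 4
  funext ε
  congr 2
  funext j
  rw [signSum_apply, lp_signSum_apply]

/-- The inclusion `ℓ_p → ℓ_q`, `p ≤ q`. -/
noncomputable def lpInclusion (𝕜 : Type*) [RCLike 𝕜] (H : Type*) [NormedAddCommGroup H]
    [NormedSpace 𝕜 H] {p q : ℝ} (hp : 1 ≤ p) (hpq : p ≤ q) [Fact (1 ≤ ENNReal.ofReal p)]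
    [Fact (1 ≤ ENNReal.ofReal q)] :
    lp (fun _ : ℕ => H) (ENNReal.ofReal p) →L[𝕜] lp (fun _ : ℕ => H) (ENNReal.ofReal q) :=
  LinearMap.mkContinuous
    { toFun := fun f => ⟨f, (lp.memℓp f).of_exponent_ge (ENNReal.ofReal_le_ofReal hpq)⟩
      map_add' := fun _ _ => rfl
      map_smul' := fun _ _ => rfl } 1 fun f => by
    rw [one_mul]
    refine le_of_tendsto_of_tendsto' (tendsto_lsSeminorm (𝕜 := 𝕜) (hp.trans hpq) _)
      (tendsto_lsSeminorm (𝕜 := 𝕜) hp f) fun n => ?_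
    exact ls_norm_anti Finset.univ (fun i => apply_nonneg _ _) (by linarith) hpq

theorem lpInclusion_apply {p q : ℝ} (hp : 1 ≤ p) (hpq : p ≤ q) [Fact (1 ≤ ENNReal.ofReal p)]
    [Fact (1 ≤ ENNReal.ofReal q)] (f : lp (fun _ : ℕ => H) (ENNReal.ofReal p)) (j : ℕ) :
    lpInclusion 𝕜 H hp hpq f j = f j := rfl

/-- The unit ball of `ℓ_r` acts on `ℓ_{r'}`. -/
theorem mem_opBall_of_sum_rpow_le {r D : ℝ} (hr : 1 ≤ r) (hD : 0 ≤ D) {n : ℕ} {z : Fin n → H}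
    (hz : ∑ j, ‖z j‖ ^ r ≤ D ^ r) :
    z ∈ opBall 𝕜 (Metric.closedBall (0 : H) D) (1 - 1 / r) n := by
  rintro x ⟨y, hy, hy1, hxy⟩
  have hr0 : 0 < r := by linarith
  have hr1 : 1 / r ≤ 1 := (div_le_one hr0).2 hr
  have hr2 : 0 < 1 / r := by positivity
  rw [mem_closedBall_zero_iff]
  have h1 := sum_geom_mean_le Finset.univ (u := fun j : Fin n => ‖z j‖ ^ r) (w := y)
    (fun j => by positivity) hy (θ := 1 - 1 / r) (by linarith) (by linarith)
  have e : ∀ t : ℝ, 0 ≤ t → (t ^ r) ^ (1 - (1 - 1 / r)) = t := fun t ht => by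
    rw [← Real.rpow_mul ht, sub_sub_cancel, mul_one_div_cancel hr0.ne', Real.rpow_one]
  have h3 : (∑ j : Fin n, ‖z j‖ ^ r) ^ (1 - (1 - 1 / r)) ≤ D :=
    (Real.rpow_le_rpow (by positivity) hz (by linarith)).trans (e _ hD).le
  have h4 : (∑ j, y j) ^ (1 - 1 / r) ≤ 1 :=
    Real.rpow_le_one (Finset.sum_nonneg fun j _ => hy j) hy1 (by linarith)
  have h5 : ‖∑ j, x j • z j‖ ≤
      ∑ j : Fin n, (‖z j‖ ^ r) ^ (1 - (1 - 1 / r)) * y j ^ (1 - 1 / r) := by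
    refine norm_sum_le_of_le _ fun j _ => ?_
    rw [norm_smul, e _ (norm_nonneg _), mul_comm]
    exact mul_le_mul_of_nonneg_left (hxy j) (norm_nonneg _)
  have h6 := mul_le_mul h3 h4 (Real.rpow_nonneg (Finset.sum_nonneg fun j _ => hy j) _) hD
  rw [mul_one] at h6
  exact h5.trans (h1.trans h6)

theorem lp_sum_rpow_le {r D : ℝ} (hr : 0 < r)
    {z : lp (fun _ : ℕ => H) (ENNReal.ofReal r)} (hz : ‖z‖ ≤ D) (n : ℕ) :
    ∑ j : Fin n, ‖z j‖ ^ r ≤ D ^ r := by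
  have h := lp.sum_rpow_le_norm_rpow (by rwa [ENNReal.toReal_ofReal hr.le]) z (Finset.range n)
  rw [ENNReal.toReal_ofReal hr.le] at h
  rw [Fin.sum_univ_eq_sum_range fun i => ‖z i‖ ^ r]
  exact h.trans (Real.rpow_le_rpow (lp.norm_nonneg' z) hz hr.le)

/-- A theorem of Bennett and Carl: the inclusion `ℓ_r → ℓ_{max 2 r}` is `(r,1)`-summing. -/
theorem isSummingWith_lpInclusion {r : ℝ} (hr : 1 ≤ r)
    (hS : ∀ D, SummingOn (𝕜 := 𝕜) (Metric.closedBall (0 : H) D) (normSeminorm 𝕜 H) 1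
      (2 * D))
    (hG : CotypeOn (normSeminorm 𝕜 H) 2 1) [Fact (1 ≤ ENNReal.ofReal r)]
    [Fact (1 ≤ ENNReal.ofReal (max 2 r))] :
    IsSummingWith r (lpInclusion 𝕜 H hr (le_max_right 2 r)) (√2 * 1 * 2) := by
  intro N x
  have hr0 : 0 < r := by linarith
  have hr1 : 1 / r ≤ 1 := (div_le_one hr0).2 hr
  have hQ : 1 ≤ max 2 r := hr.trans (le_max_right _ _)
  have h0 : 0 ≤ weakL1Norm 𝕜 x := weakL1Norm_nonneg x
  have key : ∀ D, weakL1Norm 𝕜 x < D →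
      (∑ i, ‖lpInclusion 𝕜 H hr (le_max_right 2 r) (x i)‖ ^ r) ^ (1 / r) ≤ √2 * 1 * 2 * D :=
    fun D hD => by
    have hD0 : 0 < D := h0.trans_lt hD
    -- The removal step with `r = 1`, `q = 2` and `a = 1 - 1/r = 1/r'` gives `l = r` and `Q = max 2
    -- r`. The first `n` coordinates of a vector of `ℓ_r` are read as an operator on `ℓ_{r'}ⁿ`.
    have h1 : ∀ n : ℕ, _ := fun n => (hS D).opBall_of_eq hG le_rfl one_le_two one_pos
      (by positivity) (a := 1 - 1 / r) (by linarith)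
      (by rw [one_div_one, sub_sub_cancel]; positivity) n
      (by rw [one_div_one, sub_sub_cancel, one_div, inv_inv]) rfl hQ N
      (fun i (j : Fin n) => x i j) fun c hc => by
        have h2 := mem_opBall_of_sum_rpow_le (𝕜 := 𝕜) hr hD0.le
          (lp_sum_rpow_le hr0 ((norm_sum_smul_le_weakL1Norm x hc).trans hD.le) n)
        convert h2 using 1
        funext j
        rw [lp.coeFn_sum]
        simp
    have h2 : ∑ i, ‖lpInclusion 𝕜 H hr (le_max_right 2 r) (x i)‖ ^ r ≤ (√2 * 1 * (2 * D)) ^ r :=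
      le_of_tendsto' (tendsto_finsetSum _ fun i _ => (tendsto_lsSeminorm (𝕜 := 𝕜) hQ
        (lpInclusion 𝕜 H hr (le_max_right 2 r) (x i))).rpow_const (Or.inr hr0.le)) h1
    have h3 := Real.rpow_le_rpow (by positivity) h2 (by positivity : 0 ≤ 1 / r)
    rw [← Real.rpow_mul (by positivity), mul_one_div_cancel hr0.ne', Real.rpow_one] at h3
    linarith
  have h4 : 0 < √2 * 1 * 2 := by positivity
  rw [← div_le_iff₀' h4]
  refine le_of_forall_gt_imp_ge_of_dense fun D hD => ?_
  rw [div_le_iff₀' h4]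
  exact key D hD

end Sequence

/-- The scalar multiplication of `𝕜 ∈ {ℝ, ℂ}` on `ℂ`. -/
@[reducible]
noncomputable def complexNormedSpace (𝕜 : Type*) [RCLike 𝕜] : NormedSpace 𝕜 ℂ :=
  let φ : 𝕜 →+* ℂ :=
    { toFun := fun z => ⟨RCLike.re z, RCLike.im z⟩
      map_one' := by apply Complex.ext <;> simp
      map_mul' := fun z w => by apply Complex.ext <;> simp
      map_zero' := by apply Complex.ext <;> simp
      map_add' := fun z w => by apply Complex.ext <;> simp }
  { Module.compHom ℂ φ with
    norm_smul_le := fun z w => by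
      have h : ‖φ z‖ = ‖z‖ := by
        have h1 : ‖φ z‖ ^ 2 = ‖z‖ ^ 2 := by
          rw [Complex.sq_norm, Complex.normSq_apply, RCLike.norm_sq_eq_def]
          simp [φ]
        exact (sq_eq_sq₀ (norm_nonneg _) (norm_nonneg _)).1 h1
      change ‖φ z * w‖ ≤ ‖z‖ * ‖w‖
      rw [norm_mul, h] }

/-- Pairing the two signs of `x 0`, the parallelogram law removes the cross terms. -/
theorem sum_norm_signSum_sq {H : Type*} [NormedAddCommGroup H] [InnerProductSpace ℝ H] {n : ℕ}
    (x : Fin n → H) : ∑ ε, ‖signSum x ε‖ ^ 2 = 2 ^ n * ∑ i, ‖x i‖ ^ 2 := by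
  induction n with
  | zero => simp [signSum]
  | succ n ih =>
    have h1 : ∀ b ε, signSum x (Fin.cons b ε) =
        (if b then x 0 else -x 0) + signSum (fun i => x i.succ) ε := fun b ε => by
      simp [signSum, Fin.sum_univ_succ]
    have h2 : ∀ ε : Fin n → Bool, ‖signSum x (Fin.cons false ε)‖ ^ 2 +
        ‖signSum x (Fin.cons true ε)‖ ^ 2 =
        2 * (‖x 0‖ ^ 2 + ‖signSum (fun i => x i.succ) ε‖ ^ 2) := fun ε => by
      rw [h1, h1, ← parallelogram_law_with_norm ℝ, add_comm]
      congr 2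
      rw [← norm_neg]
      congr 1
      simp
      abel
    rw [sum_cube_succ, ← Finset.sum_add_distrib, Finset.sum_congr rfl fun ε _ => h2 ε,
      ← Finset.mul_sum, Finset.sum_add_distrib, ih, Fin.sum_univ_succ]
    simp
    ring

theorem hasCotypeWith_two {H : Type*} [NormedAddCommGroup H] [InnerProductSpace ℝ H] :
    HasCotypeWith H 2 1 := fun n x => by
  have h := sum_norm_signSum_sq x
  simp only [signSum] at h
  rw [h, mul_div_cancel_left₀ _ (by positivity), one_mul, Real.sqrt_eq_rpow]
  simp

/-- Real signs adapted to the real parts, and then to the imaginary parts, bound each sum by `D`;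
hence the factor 2. -/
theorem summingOn_complex {𝕜 : Type*} [RCLike 𝕜] [NormedSpace 𝕜 ℂ] (D : ℝ) :
    SummingOn (𝕜 := 𝕜) (Metric.closedBall (0 : ℂ) D) (normSeminorm 𝕜 ℂ) 1 (2 * D) := by
  intro n x hx
  have hs : ∀ s : Fin n → Prop, [DecidablePred s] → ‖∑ i, if s i then x i else -x i‖ ≤ D :=
    fun s _ => by
    have h := hx (fun i => if s i then 1 else -1) fun i => by split_ifs <;> simp
    rw [mem_closedBall_zero_iff] at h
    have e : ∑ i, (if s i then (1 : 𝕜) else -1) • x i = ∑ i, if s i then x i else -x i :=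
      Finset.sum_congr rfl fun i _ => by split_ifs <;> simp
    rwa [e] at h
  have hre : ∑ i, |(x i).re| ≤ D := by
    refine le_trans (le_of_eq ?_) ((Complex.re_le_norm _).trans (hs fun i => 0 ≤ (x i).re))
    rw [Complex.re_sum]
    refine Finset.sum_congr rfl fun i _ => ?_
    split_ifs with h
    · exact abs_of_nonneg h
    · rw [abs_of_neg (not_le.1 h), Complex.neg_re]
  have him : ∑ i, |(x i).im| ≤ D := by
    refine le_trans (le_of_eq ?_) (((le_abs_self _).trans (Complex.abs_im_le_norm _)).trans
      (hs fun i => 0 ≤ (x i).im))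
    rw [Complex.im_sum]
    refine Finset.sum_congr rfl fun i _ => ?_
    split_ifs with h
    · exact abs_of_nonneg h
    · rw [abs_of_neg (not_le.1 h), Complex.neg_im]
  simp only [Real.rpow_one, coe_normSeminorm]
  calc ∑ i, ‖x i‖ ≤ ∑ i, (|(x i).re| + |(x i).im|) :=
        Finset.sum_le_sum fun i _ => Complex.norm_le_abs_re_add_abs_im _
    _ ≤ 2 * D := by rw [Finset.sum_add_distrib]; linarith

section Diagonal

variable {𝕜 : Type*} [RCLike 𝕜] {H : Type*} [NormedAddCommGroup H] [NormedSpace 𝕜 H]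

/-- The diagonal multilinear operator `(x¹,…,xᵐ) ↦ ∑ j, x¹_j ⋯ xᵐ_j • e_j ⊗ h` with values
in `ℓ_r`. -/
noncomputable def diagonalOperator {m : ℕ} (p : Fin m → ℝ≥0∞) [∀ j, Fact (1 ≤ p j)] (s : ℝ≥0∞)
    [Fact (1 ≤ s)] (n : ℕ) (h : H) :
    ContinuousMultilinearMap 𝕜 (fun j : Fin m => PiLp (p j) fun _ : Fin n => 𝕜)
      (lp (fun _ : ℕ => H) s) :=
  ∑ j : Fin n, ((ContinuousMultilinearMap.mkPiAlgebra 𝕜 (Fin m) 𝕜).compContinuousLinearMap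
    fun k => PiLp.proj (𝕜 := 𝕜) (p k) (fun _ : Fin n => 𝕜) j).smulRight (lp.single s (j : ℕ) h)

variable {m : ℕ} {p : Fin m → ℝ≥0∞} [∀ j, Fact (1 ≤ p j)] {n : ℕ}

theorem diagonalOperator_apply {s : ℝ≥0∞} [Fact (1 ≤ s)] (h : H)
    (x : ∀ k : Fin m, PiLp (p k) fun _ : Fin n => 𝕜) :
    diagonalOperator p s n h x = ∑ j : Fin n, lp.single s (j : ℕ) ((∏ k, x k j) • h) := by
  simp only [diagonalOperator, _root_.sum_apply,
    ContinuousMultilinearMap.smulRight_apply, lp.single_smul]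
  rfl

/-- Generalized Hölder with `∑ 1/p_k = 1/r` on unit balls, then homogeneity in each variable. -/
theorem norm_diagonalOperator_le {r : ℝ} (hr : 1 ≤ r) [Fact (1 ≤ ENNReal.ofReal r)]
    (hp : ∑ k, (p k)⁻¹.toReal = 1 / r) {h : H} (hh : ‖h‖ = 1) :
    ‖diagonalOperator (𝕜 := 𝕜) p (ENNReal.ofReal r) n h‖ ≤ 1 := by
  have hr0 : 0 < r := by linarith
  have key : ∀ x : ∀ k : Fin m, PiLp (p k) fun _ : Fin n => 𝕜, (∀ k, ‖x k‖ ≤ 1) →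
      ‖diagonalOperator p (ENNReal.ofReal r) n h x‖ ≤ 1 := fun x hx => by
    have h1 := sum_prod_rpow_le_one (a := fun k => (p k)⁻¹.toReal) hr0
      (fun k => ENNReal.toReal_nonneg) hp fun k => mem_powBall_of_norm_le_one (hx k)
    set f : ℕ → H := fun i => if hi : i < n then (∏ k, x k ⟨i, hi⟩) • h else 0 with hf
    have h2 := lp.norm_sum_single (p := ENNReal.ofReal r)
      (by rwa [ENNReal.toReal_ofReal hr0.le]) f (Finset.range n)
    have hfj : ∀ j : Fin n, f j = (∏ k, x k j) • h := fun j => by simp [hf]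
    rw [← Fin.sum_univ_eq_sum_range fun i => lp.single (ENNReal.ofReal r) i (f i),
      ← Fin.sum_univ_eq_sum_range fun i => ‖f i‖ ^ (ENNReal.ofReal r).toReal,
      ENNReal.toReal_ofReal hr0.le] at h2
    simp only [hfj, norm_smul, hh, mul_one] at h2
    rw [diagonalOperator_apply]
    refine (Real.rpow_le_rpow_iff (norm_nonneg _) zero_le_one hr0).1 ?_
    rw [h2, Real.one_rpow]
    exact h1
  refine ContinuousMultilinearMap.opNorm_le_bound zero_le_one fun x => ?_
  rw [one_mul]
  by_cases h0 : ∃ k, x k = 0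
  · obtain ⟨k, hk⟩ := h0
    rw [(diagonalOperator p (ENNReal.ofReal r) n h).map_coord_zero k hk, norm_zero]
    exact Finset.prod_nonneg fun k _ => norm_nonneg _
  · push Not at h0
    have h1 : x = fun k => ((‖x k‖ : ℝ) : 𝕜) • (((‖x k‖⁻¹ : ℝ) : 𝕜) • x k) := by
      funext k
      rw [smul_smul, ← RCLike.ofReal_mul, mul_inv_cancel₀ (norm_ne_zero_iff.2 (h0 k)),
        RCLike.ofReal_one, one_smul]
    have h2 := key (fun k => ((‖x k‖⁻¹ : ℝ) : 𝕜) • x k) fun k => by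
      rw [norm_smul, RCLike.norm_ofReal, abs_of_nonneg (by positivity),
        inv_mul_cancel₀ (norm_ne_zero_iff.2 (h0 k))]
    rw [h1, ContinuousMultilinearMap.map_smul_univ, norm_smul, ← h1, norm_prod]
    simp only [RCLike.norm_ofReal, abs_norm]
    exact mul_le_of_le_one_right (Finset.prod_nonneg fun k _ => norm_nonneg _) h2

theorem diagonalOperator_single [NeZero m] {s : ℝ≥0∞} [Fact (1 ≤ s)] (h : H) (j : Fin n) :
    diagonalOperator (𝕜 := 𝕜) p s n h (fun k => PiLp.single (p k) j (1 : 𝕜)) =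
      lp.single s (j : ℕ) h := by
  rw [diagonalOperator_apply, Finset.sum_eq_single j]
  · simp
  · intro i _ hi
    -- At least one factor is needed here: an empty product would be 1.
    have h0 : ∏ k, (PiLp.single (p k) j (1 : 𝕜) : PiLp (p k) fun _ : Fin n => 𝕜) i = 0 :=
      Finset.prod_eq_zero (Finset.mem_univ 0) (by simp [hi])
    rw [h0, zero_smul, lp.single_zero]
  · simp

end Diagonal

theorem summingNorm_nonneg {𝕜 : Type*} [RCLike 𝕜]
    {E : Type*} [NormedAddCommGroup E] [NormedSpace 𝕜 E]
    {F : Type*} [NormedAddCommGroup F] [NormedSpace 𝕜 F] (r : ℝ) (v : E →L[𝕜] F) :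
    0 ≤ summingNorm r v :=
  Real.sInf_nonneg fun _ h => h.1

/-- Testing on diagonal operators bounds `n ^ (1/t)` uniformly in `n`, which is absurd for finite
`t`. -/
theorem not_exists_bound_lpInclusion {𝕜 : Type*} [RCLike 𝕜] {H : Type*} [NormedAddCommGroup H]
    [NormedSpace 𝕜 H] {m : ℕ} {p : Fin (m + 1) → ℝ≥0∞} [∀ j, Fact (1 ≤ p j)] {r q : ℝ}
    (hr : 1 ≤ r) (hrq : r ≤ q) [Fact (1 ≤ ENNReal.ofReal r)] [Fact (1 ≤ ENNReal.ofReal q)]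
    (hp : ∑ k, (p k)⁻¹.toReal = 1 / r) {h : H} (hh : ‖h‖ = 1) {s : Fin (m + 1) → ℝ≥0∞}
    (hs : ∀ k, s k ≠ 0) {t : ℝ} (ht : 0 < t) :
    ¬ ∃ C : ℝ, ∀ (n : ℕ) (A : ContinuousMultilinearMap 𝕜
        (fun j : Fin (m + 1) => PiLp (p j) fun _ : Fin n => 𝕜)
        (lp (fun _ : ℕ => H) (ENNReal.ofReal r))),
      mixedNorm (m + 1) (Function.update s 0 (ENNReal.ofReal t))
          (coeffArray (lpInclusion 𝕜 H hr hrq) A) ≤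
        C * ‖A‖ * summingNorm r (lpInclusion 𝕜 H hr hrq) := by
  rintro ⟨C, hC⟩
  set S := summingNorm r (lpInclusion 𝕜 H hr hrq) with hSdef
  have hS : 0 ≤ S := summingNorm_nonneg _ _
  have h1 : ∀ n : ℕ, (n : ℝ) ^ (1 / t) ≤ |C| * S := fun n => by
    have hA := norm_diagonalOperator_le (𝕜 := 𝕜) (n := n) hr hp hh
    refine (rpow_le_mixedNorm (fun k => ?_) ht (Function.update_self _ _ _) _ fun j => ?_).trans
      ((hC n (diagonalOperator p (ENNReal.ofReal r) n h)).trans ?_)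
    · rcases eq_or_ne k 0 with rfl | hk
      · rw [Function.update_self]; simpa using ht
      · rw [Function.update_of_ne hk]; exact hs k
    · rw [coeffArray, diagonalOperator_single, abs_of_nonneg (norm_nonneg _), ← hh]
      have h2 := lp.norm_apply_le_norm (p := ENNReal.ofReal q)
        (by simp; linarith) (lpInclusion 𝕜 H hr hrq (lp.single (ENNReal.ofReal r) (j : ℕ) h)) j
      rwa [lpInclusion_apply, lp.single_apply_self] at h2
    · refine mul_le_mul_of_nonneg_right ?_ hS
      calc C * ‖diagonalOperator (𝕜 := 𝕜) p (ENNReal.ofReal r) n h‖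
          ≤ |C| * ‖diagonalOperator (𝕜 := 𝕜) p (ENNReal.ofReal r) n h‖ :=
            mul_le_mul_of_nonneg_right (le_abs_self C) (norm_nonneg _)
        _ ≤ |C| := mul_le_of_le_one_right (abs_nonneg C) hA
  obtain ⟨n, hn⟩ := exists_nat_gt ((|C| * S) ^ t)
  have h2 := Real.rpow_le_rpow (by positivity) (h1 n) ht.le
  rw [← Real.rpow_mul (by positivity), one_div_mul_cancel ht.ne', Real.rpow_one] at h2
  linarith

theorem HasCotype.mono {F : Type*} [NormedAddCommGroup F] {q q' : ℝ} (h : HasCotype F q)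
    (hq : 0 < q) (hqq : q ≤ q') : HasCotype F q' := by
  obtain ⟨κ, h⟩ := h
  exact ⟨κ, fun n x => (ls_norm_anti _ (fun i => norm_nonneg (x i)) hq hqq).trans (h n x)⟩

theorem exists_isAbsSumming_not_bound {𝕜 : Type*} [RCLike 𝕜] {H : Type} [NormedAddCommGroup H]
    [NormedSpace 𝕜 H] [CompleteSpace H]
    (hS : ∀ D, SummingOn (𝕜 := 𝕜) (Metric.closedBall (0 : H) D) (normSeminorm 𝕜 H) 1
      (2 * D))
    (hG : HasCotypeWith H 2 1) {h : H} (hh : ‖h‖ = 1) {m : ℕ} {hm : 2 ≤ m + 1}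
    {p : Fin (m + 1) → ℝ≥0∞} [∀ j, Fact (1 ≤ p j)] {r q : ℝ} {k₀ : Fin (m + 1)}
    (hcrit : IsCritical hm p r q k₀) :
    ∃ (E : Type) (_ : NormedAddCommGroup E) (_ : NormedSpace 𝕜 E) (_ : CompleteSpace E)
        (F : Type) (_ : NormedAddCommGroup F) (_ : NormedSpace 𝕜 F) (_ : CompleteSpace F)
        (v : E →L[𝕜] F),
      HasCotype F q ∧ IsAbsSumming r v ∧
      ∀ t : ℝ, 0 < t → ¬ ∃ C : ℝ, ∀ (n : ℕ)
        (A : ContinuousMultilinearMap 𝕜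
          (fun j : Fin (m + 1) => PiLp (p j) fun _ : Fin n => 𝕜) E),
      mixedNorm (m + 1) (Function.update (critExponent p r q k₀) 0 (ENNReal.ofReal t))
          (coeffArray v A) ≤ C * ‖A‖ * summingNorm r v := by
  have hr := hcrit.one_le_r
  have hG' : CotypeOn (normSeminorm 𝕜 H) 2 1 := fun n x => hG n x
  have : Fact (1 ≤ ENNReal.ofReal r) := ⟨ENNReal.one_le_ofReal.2 hr⟩
  have : Fact (1 ≤ ENNReal.ofReal (max 2 r)) :=
    ⟨ENNReal.one_le_ofReal.2 (hr.trans (le_max_right _ _))⟩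
  refine ⟨lp (fun _ : ℕ => H) (ENNReal.ofReal r), inferInstance, inferInstance, inferInstance,
    lp (fun _ : ℕ => H) (ENNReal.ofReal (max 2 r)), inferInstance, inferInstance, inferInstance,
    lpInclusion 𝕜 H hr (le_max_right 2 r), ?_, ⟨_, isSummingWith_lpInclusion hr hS hG'⟩,
    fun t ht => not_exists_bound_lpInclusion hr _ hcrit.sum_eq hh (fun k => ?_) ht⟩
  · have h1 : HasCotype (lp (fun _ : ℕ => H) (ENNReal.ofReal (max 2 r))) (max 2 r) :=
      ⟨1, hasCotypeWith_lp (le_max_left 2 r) zero_le_one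
        (hG'.mono two_pos (le_max_left 2 r))⟩
    -- Both `2 ≤ q` and `r ≤ q` are used: the target has cotype `max 2 r`.
    exact h1.mono (by positivity) (max_le hcrit.two_le_q hcrit.r_le_q)
  · rw [critExponent_eq hcrit]
    exact ENNReal.inv_ne_zero.2 ENNReal.ofReal_ne_top

theorem mainTheorem5 {𝕜 : Type*} [RCLike 𝕜] (m : ℕ) (hm : 2 ≤ m) :
    (∀ κ : ℝ, ∃ C : ℝ, ∀ (p : Fin m → ℝ≥0∞) [∀ j, Fact (1 ≤ p j)] (r q : ℝ) (k₀ : Fin m),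
      IsCritical hm p r q k₀ →
      ∀ (E : Type*) [NormedAddCommGroup E] [NormedSpace 𝕜 E] [CompleteSpace E]
        (F : Type*) [NormedAddCommGroup F] [NormedSpace 𝕜 F] [CompleteSpace F],
      HasCotypeWith F q κ →
      ∀ v : E →L[𝕜] F, IsAbsSumming r v →
      ∀ (n : ℕ)
        (A : ContinuousMultilinearMap 𝕜 (fun j : Fin m => PiLp (p j) fun _ : Fin n => 𝕜) E),
      mixedNorm m (critExponent p r q k₀) (coeffArray v A) ≤ C * ‖A‖ * summingNorm r v) ∧
    (∀ (p : Fin m → ℝ≥0∞) [∀ j, Fact (1 ≤ p j)] (r q : ℝ) (k₀ : Fin m),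
      IsCritical hm p r q k₀ →
      critExponent p r q k₀ ⟨0, by omega⟩ = ∞ ∧
      ∃ (E : Type) (_ : NormedAddCommGroup E) (_ : NormedSpace 𝕜 E) (_ : CompleteSpace E)
        (F : Type) (_ : NormedAddCommGroup F) (_ : NormedSpace 𝕜 F) (_ : CompleteSpace F)
        (v : E →L[𝕜] F),
      HasCotype F q ∧ IsAbsSumming r v ∧
      ∀ t : ℝ, 0 < t → ¬ ∃ C : ℝ, ∀ (n : ℕ)
        (A : ContinuousMultilinearMap 𝕜 (fun j : Fin m => PiLp (p j) fun _ : Fin n => 𝕜) E),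
      mixedNorm m
          (Function.update (critExponent p r q k₀) ⟨0, by omega⟩ (ENNReal.ofReal t))
          (coeffArray v A) ≤ C * ‖A‖ * summingNorm r v) := by
  obtain ⟨m, rfl⟩ : ∃ k, m = k + 1 := ⟨m - 1, by omega⟩
  refine ⟨fun κ => ⟨(√2 * max κ 1) ^ m, ?_⟩, ?_⟩
  · intro p _ r q k₀ hcrit E _ _ _ F _ _ _ hF v hv n A
    exact mixedNorm_critExponent_le_summingNorm hcrit hF hv A
  · intro p _ r q k₀ hcrit
    refine ⟨critExponent_zero hcrit, ?_⟩
    -- The spaces must lie in `Type`, but `𝕜` may lie in any universe; so `ℂ`, viewed as a space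
    -- over `𝕜`, serves as the coefficient space.
    let _ : NormedSpace 𝕜 ℂ := complexNormedSpace 𝕜
    exact exists_isAbsSumming_not_bound (H := ℂ) summingOn_complex hasCotypeWith_two
      (h := 1) norm_one hcrit
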